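/- Let $k$ be an algebraically closed field of characteristic zero. Let $Q_A$ and $Q_B$ be finite quivers with the same vertex set $\{1,\dots,n\}$ such that every arrow $i\to j$ of $Q_A$ or of $Q_B$ satisfies $i<j$, and let $A=kQ_A/I_A$ and $B=kQ_B/I_B$, where $I_A$ and $I_B$ are generated by sets $Z_A$ and $Z_B$ of paths of length at least two (that is, $A$ and $B$ are directed monomial algebras with the same ordering of the vertices). Paths are composed from right to left. Let $\Lambda=\Lambda(B,A^{\mathrm{op}})=kQ/I$ be the dual extension algebra: $Q$ has vertices $1,\dots,n$, and its arrows are the arrows of $Q_B$ together with an arrow $\beta'\colon j\to i$ for each arrow $\beta\colon i\to j$ of $Q_A$; the ideal $I$ is generated by $Z_B$, by the reversed paths of $Z_A$, and by all paths $\alpha\beta'$ (first $\beta'$, then $\alpha$) with $\alpha$ an arrow of $Q_B$ and $\beta$ an arrow of $Q_A$. Regard $B$ as a subalgebra of $\Lambda$. For a $k$-algebra $R$ and a subalgebra $S\subseteq R$ let $\mathrm{HH}^1(R)=\mathrm{Der}_k(R)/\mathrm{Inn}_k(R)$ and let $\mathrm{HH}^1(R|S)=\mathrm{Der}_{S^e}(R)/\mathrm{Inn}_{S^e}(R)$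 be the quotient of the derivations that are $S$-bimodule maps by the inner derivations that are $S$-bimodule maps; both are Lie algebras under the commutator bracket. If $R=\Lambda$ or $R=B$, graded by path length, let $\mathrm{HH}^1(R)_{|_1}$ and $\mathrm{HH}^1(R|S)_{|_1}$ be the Lie subalgebras of the classes represented by derivations (in the second case, derivations that are $S$-bimodule maps) that preserve the path length grading, i.e. that send each arrow to a linear combination of parallel arrows. Then there is an isomorphism of Lie algebras \[ \mathrm{HH}^1(\Lambda)_{|_1}\;\cong\;\mathrm{HH}^1(B)_{|_1}\oplus \mathrm{HH}^1(\Lambda|B)_{|_1}. \] -/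

import Mathlib

universe u v w

noncomputable section

namespace DualExt

/-! ### Paths and path algebras

Quivers are Mathlib's `Quiver`, handled as explicit terms because several quivers on the same
vertex set occur at once. -/

/-- A path in the quiver `Q`, together with its source and its target. -/
structure QPath {V : Type w} (Q : Quiver.{v} V) where
  src : V
  tgt : V
  path : @Quiver.Path V Q src tgt

namespace QPath

variable {V : Type w} {Q : Quiver.{v} V}

/-- The number of arrows in a path. -/
def length (p : QPath Q) : ℕ := @Quiver.Path.length V Q _ _ p.path

/-- The path of length zero at a vertex. -/
def idem (Q : Quiver.{v} V) (i : V) : QPath Q := ⟨i, i, @Quiver.Path.nil V Q i⟩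

/-- The path of length one given by an arrow. -/
def arrow {i j : V} (a : Q.Hom i j) : QPath Q := ⟨i, j, @Quiver.Hom.toPath V Q i j a⟩

/-- The concatenation `p q`, written from right to left: first `q`, then `p`. -/
def comp (p q : QPath Q) (h : q.tgt = p.src) : QPath Q :=
  ⟨q.src, p.tgt, @Quiver.Path.comp V Q _ _ _ (@Quiver.Path.cast V Q _ _ _ _ rfl h q.path) p.path⟩

/-- The image of a path under a map of quivers which is the identity on vertices. -/
def map {Q' : Quiver.{v} V} (φ : ∀ i j, Q.Hom i j → Q'.Hom i j) (p : QPath Q) : QPath Q' :=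
  ⟨p.src, p.tgt, @Prefunctor.mapPath V Q V Q' (@Prefunctor.mk V Q V Q' id (fun {i j} a => φ i j a))
    _ _ p.path⟩

theorem comp_assoc (p q r : QPath Q) (h : q.tgt = p.src) (h' : r.tgt = q.src) :
    comp (comp p q h) r h' = comp p (comp q r h') h := by
  obtain ⟨a, b, p⟩ := p
  obtain ⟨c, d, q⟩ := q
  obtain ⟨e, f, r⟩ := r
  dsimp at h h'
  subst h h'
  simp [comp]

theorem comp_idem (p : QPath Q) (i : V) (h : i = p.src) : comp p (idem Q i) h = p := by
  obtain ⟨a, b, p⟩ := p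
  dsimp at h
  subst h
  simp [comp, idem]

theorem idem_comp (p : QPath Q) (i : V) (h : p.tgt = i) : comp (idem Q i) p h = p := by
  obtain ⟨a, b, p⟩ := p
  dsimp at h
  subst h
  simp [comp, idem]

theorem map_comp {Q' : Quiver.{v} V} (φ : ∀ i j, Q.Hom i j → Q'.Hom i j) (p q : QPath Q)
    (h : q.tgt = p.src) : map φ (comp p q h) = comp (map φ p) (map φ q) h := by
  obtain ⟨a, b, p⟩ := p
  obtain ⟨c, d, q⟩ := q
  dsimp at h
  subst h
  simp [comp, map]

end QPath

/-- The path algebra `kQ`: the vector space with basis the paths of `Q`. -/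
def PathAlgebra (k : Type u) [Field k] {V : Type w} (Q : Quiver.{v} V) :
    Type (max u v w) :=
  QPath Q →₀ k

namespace PathAlgebra

variable (k : Type u) [Field k] {V : Type w}

instance (Q : Quiver.{v} V) : AddCommGroup (PathAlgebra k Q) :=
  inferInstanceAs (AddCommGroup (QPath Q →₀ k))

instance (Q : Quiver.{v} V) : Module k (PathAlgebra k Q) :=
  inferInstanceAs (Module k (QPath Q →₀ k))

/-- The basis element of the path algebra given by a path. -/
def of {Q : Quiver.{v} V} (p : QPath Q) : PathAlgebra k Q :=
  (Finsupp.single p 1 : QPath Q →₀ k)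

/-- The linear map on the path algebra with prescribed values on the paths. -/
def extend {Q : Quiver.{v} V} {M : Type*} [AddCommGroup M] [Module k M] (f : QPath Q → M) :
    PathAlgebra k Q →ₗ[k] M :=
  Finsupp.linearCombination k f

variable {k}

@[simp]
theorem extend_of {Q : Quiver.{v} V} {M : Type*} [AddCommGroup M] [Module k M]
    (f : QPath Q → M) (p : QPath Q) : extend k f (of k p) = f p := by
  exact (Finsupp.linearCombination_single k 1 p).trans (one_smul k (f p))

theorem hom_ext {Q : Quiver.{v} V} {M : Type*} [AddCommGroup M] [Module k M]
    {f g : PathAlgebra k Q →ₗ[k] M} (h : ∀ p, f (of k p) = g (of k p)) : f = g :=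
  Finsupp.lhom_ext' fun p => LinearMap.ext_ring (h p)

variable (k) [DecidableEq V]

/-- The product of two paths: their concatenation if they can be composed, and zero otherwise. -/
def mulPath {Q : Quiver.{v} V} (p q : QPath Q) : PathAlgebra k Q :=
  if h : q.tgt = p.src then of k (p.comp q h) else 0

/-- The multiplication of the path algebra. -/
def mulHom (Q : Quiver.{v} V) :
    PathAlgebra k Q →ₗ[k] PathAlgebra k Q →ₗ[k] PathAlgebra k Q :=
  extend k fun p => extend k fun q => mulPath k p q

variable {k}

@[simp]
theorem mulHom_of {Q : Quiver.{v} V} (p q : QPath Q) :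
    mulHom k Q (of k p) (of k q) = mulPath k p q := by
  simp [mulHom]

theorem mulHom_assoc {Q : Quiver.{v} V} (x y z : PathAlgebra k Q) :
    mulHom k Q (mulHom k Q x y) z = mulHom k Q x (mulHom k Q y z) := by
  have key : ∀ p q r : QPath Q, mulHom k Q (mulHom k Q (of k p) (of k q)) (of k r) =
      mulHom k Q (of k p) (mulHom k Q (of k q) (of k r)) := by
    intro p q r
    by_cases h : q.tgt = p.src
    · by_cases h' : r.tgt = q.src
      · have h1 : (q.comp r h').tgt = p.src := h
        have h2 : r.tgt = (p.comp q h).src := h'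
        simp only [mulHom_of, mulPath, dif_pos h, dif_pos h', dif_pos h1, dif_pos h2]
        exact congrArg (of k) (QPath.comp_assoc p q r h h')
      · have h2 : ¬ r.tgt = (p.comp q h).src := h'
        simp [mulPath, h, h', h2]
    · by_cases h' : r.tgt = q.src
      · have h1 : ¬ (q.comp r h').tgt = p.src := h
        simp [mulPath, h, h', h1]
      · simp [mulPath, h, h']
  have key₁ : ∀ (p q : QPath Q) (z : PathAlgebra k Q),
      mulHom k Q (mulHom k Q (of k p) (of k q)) z =
        mulHom k Q (of k p) (mulHom k Q (of k q) z) := fun p q z =>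
    LinearMap.congr_fun (f := mulHom k Q (mulHom k Q (of k p) (of k q)))
      (g := (mulHom k Q (of k p)).comp (mulHom k Q (of k q))) (hom_ext (key p q)) z
  have key₂ : ∀ (p : QPath Q) (y z : PathAlgebra k Q),
      mulHom k Q (mulHom k Q (of k p) y) z =
        mulHom k Q (of k p) (mulHom k Q y z) := fun p y z =>
    LinearMap.congr_fun (f := ((mulHom k Q).flip z).comp (mulHom k Q (of k p)))
      (g := (mulHom k Q (of k p)).comp ((mulHom k Q).flip z))
      (hom_ext fun q => key₁ p q z) y
  exact LinearMap.congr_fun (f := ((mulHom k Q).flip z).comp ((mulHom k Q).flip y))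
    (g := (mulHom k Q).flip (mulHom k Q y z)) (hom_ext fun p => key₂ p y z) x

variable [Fintype V]

/-- The unit of the path algebra: the sum of the paths of length zero. -/
def one (k : Type u) [Field k] (Q : Quiver.{v} V) : PathAlgebra k Q :=
  ∑ i : V, of k (QPath.idem Q i)

theorem one_mulHom {Q : Quiver.{v} V} (x : PathAlgebra k Q) :
    mulHom k Q (one k Q) x = x := by
  have : mulHom k Q (one k Q) = LinearMap.id := by
    refine hom_ext fun p => ?_
    simp only [one, map_sum, LinearMap.sum_apply, mulHom_of, LinearMap.id_apply]
    rw [Finset.sum_eq_single p.tgt]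
    · exact (dif_pos rfl).trans (congrArg (of k) (QPath.idem_comp p _ rfl))
    · intro i _ hi
      exact dif_neg (fun h => hi h.symm)
    · simp
  rw [this, LinearMap.id_apply]

theorem mulHom_one {Q : Quiver.{v} V} (x : PathAlgebra k Q) :
    mulHom k Q x (one k Q) = x := by
  have : (mulHom k Q).flip (one k Q) = LinearMap.id := by
    refine hom_ext fun p => ?_
    simp only [one, map_sum, LinearMap.sum_apply, LinearMap.flip_apply, mulHom_of,
      LinearMap.id_apply]
    rw [Finset.sum_eq_single p.src]
    · exact (dif_pos rfl).trans (congrArg (of k) (QPath.comp_idem p _ rfl))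
    · intro i _ hi
      exact dif_neg (fun h => hi h)
    · simp
  exact congr($this x)

instance (Q : Quiver.{v} V) : Ring (PathAlgebra k Q) :=
  { (inferInstance : AddCommGroup (PathAlgebra k Q)) with
    mul := fun x y => mulHom k Q x y
    one := one k Q
    left_distrib := fun x y z => map_add (mulHom k Q x) y z
    right_distrib := fun x y z => LinearMap.map_add₂ (mulHom k Q) x y z
    zero_mul := fun x => LinearMap.map_zero₂ (mulHom k Q) x
    mul_zero := fun x => map_zero (mulHom k Q x)
    mul_assoc := mulHom_assoc
    one_mul := one_mulHom
    mul_one := mulHom_one }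

theorem mul_def {Q : Quiver.{v} V} (x y : PathAlgebra k Q) : x * y = mulHom k Q x y := rfl

theorem one_def (Q : Quiver.{v} V) :
    (1 : PathAlgebra k Q) = ∑ i : V, of k (QPath.idem Q i) := rfl

instance (Q : Quiver.{v} V) : Algebra k (PathAlgebra k Q) :=
  Algebra.ofModule
    (fun r x y => LinearMap.map_smul₂ (mulHom k Q) r x y)
    (fun r x y => map_smul (mulHom k Q x) r y)

/-- The homomorphism of path algebras induced by a map of quivers which is the identity on
vertices. -/
def map {Q Q' : Quiver.{v} V} (φ : ∀ i j, Q.Hom i j → Q'.Hom i j) :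
    PathAlgebra k Q →ₐ[k] PathAlgebra k Q' :=
  AlgHom.ofLinearMap (extend k fun p => of k (p.map φ))
    (by simp only [one_def, map_sum, extend_of]; rfl)
    (by
      intro x y
      have : (mulHom k Q).compr₂ (extend k fun p => of k (p.map φ)) =
          (mulHom k Q').compl₁₂ (extend k fun p => of k (p.map φ))
            (extend k fun p => of k (p.map φ)) := by
        refine hom_ext fun p => hom_ext fun q => ?_
        simp only [LinearMap.compr₂_apply, LinearMap.compl₁₂_apply, mulHom_of, extend_of]
        by_cases h : q.tgt = p.src
        · have h' : (q.map φ).tgt = (p.map φ).src := h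
          simp only [mulPath, dif_pos h, dif_pos h', extend_of, QPath.map_comp]
        · have h' : ¬ (q.map φ).tgt = (p.map φ).src := h
          simp only [mulPath, dif_neg h, dif_neg h', map_zero]
      exact congr($this x y))

@[simp]
theorem map_of {Q Q' : Quiver.{v} V} (φ : ∀ i j, Q.Hom i j → Q'.Hom i j) (p : QPath Q) :
    map φ (of k p) = of k (p.map φ) :=
  extend_of _ p

end PathAlgebra

/-! ### Monomial algebras and dual extensions -/

section Monomial

variable (k : Type u) [Field k] {V : Type w} [DecidableEq V] [Fintype V]

/-- The two-sided ideal of `kQ` generated by a set `Z` of paths. -/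
def relIdeal {Q : Quiver.{v} V} (Z : Set (QPath Q)) : Ideal (PathAlgebra k Q) :=
  (TwoSidedIdeal.span (PathAlgebra.of k '' Z)).asIdeal

instance {Q : Quiver.{v} V} (Z : Set (QPath Q)) : (relIdeal k Z).IsTwoSided :=
  inferInstanceAs (TwoSidedIdeal.span (PathAlgebra.of k '' Z)).asIdeal.IsTwoSided

/-- The monomial algebra `kQ / (Z)`. -/
abbrev MonomialAlgebra {Q : Quiver.{v} V} (Z : Set (QPath Q)) : Type (max u v w) :=
  PathAlgebra k Q ⧸ relIdeal k Z

/-- The grading of `kQ / (Z)` by path length: the component of degree `n` is spanned by the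
residue classes of the paths of length `n`. -/
def lengthGrading {Q : Quiver.{v} V} (Z : Set (QPath Q)) (n : ℕ) :
    Submodule k (MonomialAlgebra k Z) :=
  Submodule.span k
    ((fun p : QPath Q => Ideal.Quotient.mk (relIdeal k Z) (PathAlgebra.of k p)) ''
      {p | p.length = n})

end Monomial

section DualExtension

variable {V : Type w}

/-- The quiver of the dual extension of `B` and `A`: it has the given vertices, the arrows of
`Q_B`, and an arrow from `i` to `j` for every arrow of `Q_A` from `j` to `i`. -/
@[reducible]
def dualQuiver (QB QA : Quiver.{v} V) : Quiver.{v} V :=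
  ⟨fun i j => QB.Hom i j ⊕ QA.Hom j i⟩

/-- The arrow of the dual extension given by an arrow of `Q_B`. -/
def inclArrow (QB QA : Quiver.{v} V) (i j : V) (b : QB.Hom i j) : (dualQuiver QB QA).Hom i j :=
  Sum.inl b

/-- The arrow of the dual extension given by (the opposite of) an arrow of `Q_A`. -/
def opArrow (QB QA : Quiver.{v} V) (i j : V) (a : QA.Hom i j) : (dualQuiver QB QA).Hom j i :=
  Sum.inr a

/-- The path in the dual extension obtained from a path of `Q_A` by reversing it. -/
def opPathAux (QB QA : Quiver.{v} V) {i : V} :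
    ∀ {j : V}, @Quiver.Path V QA i j → @Quiver.Path V (dualQuiver QB QA) j i
  | _, @Quiver.Path.nil _ _ _ => @Quiver.Path.nil V (dualQuiver QB QA) i
  | _, @Quiver.Path.cons _ _ _ _ _ p a =>
      @Quiver.Path.comp V (dualQuiver QB QA) _ _ _
        (@Quiver.Hom.toPath V (dualQuiver QB QA) _ _ (opArrow QB QA _ _ a)) (opPathAux QB QA p)

/-- The path in the dual extension obtained from a path of `Q_A` by reversing it. -/
def opPath (QB QA : Quiver.{v} V) (p : QPath QA) : QPath (dualQuiver QB QA) :=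
  ⟨p.tgt, p.src, opPathAux QB QA p.path⟩

/-- The relations of the dual extension `Λ(B, A^op)`: the relations of `B`, the reversed
relations of `A`, and all paths `α β'` of length two (first `β'`, then `α`) with `α` an arrow of
`Q_B` and `β'` the opposite of an arrow of `Q_A`. -/
def dualRelations {QB QA : Quiver.{v} V} (ZB : Set (QPath QB)) (ZA : Set (QPath QA)) :
    Set (QPath (dualQuiver QB QA)) :=
  QPath.map (inclArrow QB QA) '' ZB ∪ opPath QB QA '' ZA ∪
    {r | ∃ (i j l : V) (β : QA.Hom j i) (α : QB.Hom j l),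
      r = (QPath.arrow (inclArrow QB QA j l α)).comp (QPath.arrow (opArrow QB QA j i β)) rfl}

end DualExtension

section Borel

variable (k : Type u) [Field k] {V : Type w} [DecidableEq V] [Fintype V]

theorem relIdeal_le_comap {QB QA : Quiver.{v} V} (ZB : Set (QPath QB)) (ZA : Set (QPath QA))
    (x : PathAlgebra k QB) (hx : x ∈ relIdeal k ZB) :
    PathAlgebra.map (inclArrow QB QA) x ∈ relIdeal k (dualRelations ZB ZA) := by
  have h : TwoSidedIdeal.span (PathAlgebra.of k '' ZB) ≤
      (TwoSidedIdeal.span (PathAlgebra.of k '' dualRelations ZB ZA)).comap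
        (PathAlgebra.map (k := k) (inclArrow QB QA)) := by
    rw [TwoSidedIdeal.span_le]
    rintro _ ⟨p, hp, rfl⟩
    rw [SetLike.mem_coe, TwoSidedIdeal.mem_comap, PathAlgebra.map_of]
    exact TwoSidedIdeal.subset_span ⟨_, Or.inl (Or.inl ⟨p, hp, rfl⟩), rfl⟩
  exact TwoSidedIdeal.mem_asIdeal.2
    ((TwoSidedIdeal.mem_comap _).1 (h (TwoSidedIdeal.mem_asIdeal.1 hx)))

/-- The dual extension algebra `Λ(B, A^op)` of `B = kQ_B / (Z_B)` and `A = kQ_A / (Z_A)`. -/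
abbrev DualExtension {QB QA : Quiver.{v} V} (ZB : Set (QPath QB)) (ZA : Set (QPath QA)) :
    Type (max u v w) :=
  MonomialAlgebra k (dualRelations ZB ZA)

/-- The canonical homomorphism from `B` to `Λ(B, A^op)`, sending a path to the same path. -/
def borelHom {QB QA : Quiver.{v} V} (ZB : Set (QPath QB)) (ZA : Set (QPath QA)) :
    MonomialAlgebra k ZB →ₐ[k] DualExtension k ZB ZA :=
  Ideal.quotientMapₐ (relIdeal k (dualRelations ZB ZA)) (PathAlgebra.map (inclArrow QB QA))
    (fun x hx => relIdeal_le_comap k ZB ZA x hx)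

/-- `B` as a subalgebra of `Λ(B, A^op)`. -/
def borel {QB QA : Quiver.{v} V} (ZB : Set (QPath QB)) (ZA : Set (QPath QA)) :
    Subalgebra k (DualExtension k ZB ZA) :=
  (borelHom k ZB ZA).range

end Borel

/-! ### First (relative) Hochschild cohomology as a Lie algebra -/

section Hochschild

attribute [local instance 100] LieRing.ofAssociativeRing

variable (k : Type u) [Field k] (A : Type v) [Ring A] [Algebra k A]

/-- The Lie algebra `Der_k(A)`, with the commutator bracket `f ∘ g - g ∘ f`. -/
def derivations : LieSubalgebra k (Module.End k A) where
  carrier := {f | ∀ x y, f (x * y) = f x * y + x * f y}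
  add_mem' := by
    intro f g hf hg x y
    simp only [LinearMap.add_apply, hf x y, hg x y, add_mul, mul_add]
    abel
  zero_mem' := by
    intro x y
    simp
  smul_mem' := by
    intro c f hf x y
    simp [hf x y]
  lie_mem' := by
    intro f g hf hg x y
    have hf' : ∀ x y, f (x * y) = f x * y + x * f y := hf
    have hg' : ∀ x y, g (x * y) = g x * y + x * g y := hg
    simp only [LieRing.of_associative_ring_bracket, LinearMap.sub_apply, Module.End.mul_apply,
      hf', hg', map_add, sub_mul, mul_sub]
    abel

variable {A}

/-- The Lie algebra of the endomorphisms of `A` as a `B`-bimodule. -/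
def bimoduleEnd (B : Subalgebra k A) : LieSubalgebra k (Module.End k A) where
  carrier := {f | ∀ b ∈ B, ∀ b' ∈ B, ∀ x, f (b * x * b') = b * f x * b'}
  add_mem' := by
    intro f g hf hg b hb b' hb' x
    simp only [LinearMap.add_apply, hf b hb b' hb' x, hg b hb b' hb' x, add_mul, mul_add]
  zero_mem' := by
    intro b hb b' hb' x
    simp
  smul_mem' := by
    intro c f hf b hb b' hb' x
    simp [hf b hb b' hb' x]
  lie_mem' := by
    intro f g hf hg b hb b' hb' x
    simp only [LieRing.of_associative_ring_bracket, LinearMap.sub_apply, Module.End.mul_apply,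
      hf b hb b' hb' _, hg b hb b' hb' _, sub_mul, mul_sub]

/-- The Lie algebra `Der_{B^e}(A)` of derivations of `A` that are maps of `B`-bimodules. -/
def relDerivations (B : Subalgebra k A) : LieSubalgebra k (Module.End k A) :=
  derivations k A ⊓ bimoduleEnd k B

/-- The inner derivation `y ↦ x y - y x`. -/
def ad (x : A) : Module.End k A := LinearMap.mulLeft k x - LinearMap.mulRight k x

theorem lie_ad {f : Module.End k A} (hf : f ∈ derivations k A) (x : A) :
    ⁅f, ad k x⁆ = ad k (f x) := by
  have hf' : ∀ x y, f (x * y) = f x * y + x * f y := hf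
  ext y
  simp only [LieRing.of_associative_ring_bracket, LinearMap.sub_apply, Module.End.mul_apply, ad,
    LinearMap.mulLeft_apply, LinearMap.mulRight_apply, map_sub, hf']
  abel

theorem ad_add (x y : A) : ad k (x + y) = ad k x + ad k y := by
  ext z
  simp only [ad, LinearMap.sub_apply, LinearMap.mulLeft_apply, LinearMap.mulRight_apply,
    LinearMap.add_apply, add_mul, mul_add]
  abel

theorem ad_smul (c : k) (x : A) : ad k (c • x) = c • ad k x := by
  ext z
  simp [ad, smul_sub]

/-- The inner derivations that lie in a Lie algebra `D` of derivations, as an ideal of `D`. -/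
def innerIdeal (D : LieSubalgebra k (Module.End k A)) (hD : D ≤ derivations k A) :
    LieIdeal k D where
  carrier := {f | ∃ x : A, (f : Module.End k A) = ad k x}
  add_mem' := by
    rintro f g ⟨x, hx⟩ ⟨y, hy⟩
    exact ⟨x + y, by rw [ad_add, ← hx, ← hy]; rfl⟩
  zero_mem' := ⟨0, by ext; simp [ad]⟩
  smul_mem' := by
    rintro c f ⟨x, hx⟩
    exact ⟨c • x, by rw [ad_smul, ← hx]; rfl⟩
  lie_mem := by
    rintro f g ⟨x, hx⟩
    exact ⟨(f : Module.End k A) x, by rw [← lie_ad k (hD f.2), ← hx]; rfl⟩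

variable (A) in
/-- The first Hochschild cohomology `HH¹(A) = Der_k(A) / Inn_k(A)`. -/
abbrev HH1 : Type v := derivations k A ⧸ innerIdeal k (derivations k A) le_rfl

/-- The first relative Hochschild cohomology `HH¹(A|B) = Der_{B^e}(A) / Inn_{B^e}(A)`. -/
abbrev RelHH1 (B : Subalgebra k A) : Type v :=
  relDerivations k B ⧸ innerIdeal k (relDerivations k B) inf_le_left

/-- The endomorphisms of `A` that map every component of a grading to itself. -/
def degreePreserving (𝒜 : ℕ → Submodule k A) : LieSubalgebra k (Module.End k A) where
  carrier := {f | ∀ n, ∀ x ∈ 𝒜 n, f x ∈ 𝒜 n}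
  add_mem' := by
    intro f g hf hg n x hx
    exact add_mem (hf n x hx) (hg n x hx)
  zero_mem' := by
    intro n x _
    exact zero_mem _
  smul_mem' := by
    intro c f hf n x hx
    exact Submodule.smul_mem _ c (hf n x hx)
  lie_mem' := by
    intro f g hf hg n x hx
    exact sub_mem (hf n _ (hg n x hx)) (hg n _ (hf n x hx))

/-- The classes in `D / I` that are represented by elements of `D` lying in `P`. -/
def classesIn (D P : LieSubalgebra k (Module.End k A)) (I : LieIdeal k D) :
    LieSubalgebra k (D ⧸ I) where
  carrier := {c | ∃ f : D, (f : Module.End k A) ∈ P ∧ LieSubmodule.Quotient.mk f = c}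
  add_mem' := by
    rintro _ _ ⟨f, hf, rfl⟩ ⟨g, hg, rfl⟩
    exact ⟨f + g, add_mem hf hg, rfl⟩
  zero_mem' := ⟨0, zero_mem P, rfl⟩
  smul_mem' := by
    rintro c _ ⟨f, hf, rfl⟩
    exact ⟨c • f, P.smul_mem c hf, rfl⟩
  lie_mem' := by
    rintro _ _ ⟨f, hf, rfl⟩ ⟨g, hg, rfl⟩
    exact ⟨⁅f, g⁆, P.lie_mem hf hg, rfl⟩

/-- The component `HH¹(A)_{|1}` of degree one, for a graded algebra `A`. In the grading of `HH¹`
used here, the component of degree `i` consists of the classes of the derivations that map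
the component `n` of `A` to the component `n + i - 1`. So in degree one the derivations preserve
the grading of `A` (an arrow is sent to a combination of parallel arrows). -/
def HH1DegOne (𝒜 : ℕ → Submodule k A) : LieSubalgebra k (HH1 k A) :=
  classesIn k (derivations k A) (degreePreserving k 𝒜) _

/-- The component `HH¹(A|B)_{|1}` of degree one, with the same convention. -/
def RelHH1DegOne (𝒜 : ℕ → Submodule k A) (B : Subalgebra k A) : LieSubalgebra k (RelHH1 k B) :=
  classesIn k (relDerivations k B) (degreePreserving k 𝒜) _

end Hochschild

end DualExt

end

/-!
Write `Der(R)` for the derivations of `R` that preserve the path length. They send an arrow to a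
combination of parallel arrows, and in the dual extension no arrow of `B` is parallel to a reversed
arrow of `A`. Hence the derivations in `Der(Λ)` restrict to `B`, and the kernel of the restriction
`Der(Λ) → Der(B)` consists of the derivations that are maps of `B`-bimodules. The products `α β'`
being zero, a derivation of `B` extends to `Λ` by zero on the arrows of `A`. This is a section of
the restriction whose image commutes with the kernel, so that `Der(Λ)` is the product of `Der(B)`
and the kernel.

The inner derivations of degree zero are given by the combinations of vertices. They are central,
but they lie diagonally in the product. The traces on the spans of parallel arrows vanish on
brackets, and in characteristic zero an inner derivation is determined by its traces. They thus
give a linear map `φ` on `Der(B)` that vanishes on brackets and recovers the inner derivations, and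
the homomorphism `f ↦ f - ad (φ (f|_B))` moves the inner derivations of `Λ` into the kernel.
-/

noncomputable section

namespace DualExt

attribute [local instance 100] LieRing.ofAssociativeRing

section SplitExtension

variable {k L M L' M' K' : Type*} [CommRing k] [LieRing L] [LieAlgebra k L] [LieRing M]
  [LieAlgebra k M] [LieRing L'] [LieAlgebra k L'] [LieRing M'] [LieAlgebra k M'] [LieRing K']
  [LieAlgebra k K']

theorem nonempty_quotKer_lieEquiv (f : L →ₗ⁅k⁆ M) (hf : Function.Surjective f) :
    Nonempty ((L ⧸ f.ker) ≃ₗ⁅k⁆ M) :=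
  ⟨f.quotKerEquivRange.trans
    ((LieEquiv.ofEq _ _ (by rw [f.range_eq_top.2 hf])).trans LieSubalgebra.topEquiv)⟩

theorem nonempty_lieEquiv_of_ker_eq (f : L →ₗ⁅k⁆ L') (g : L →ₗ⁅k⁆ M')
    (hf : Function.Surjective f) (hg : Function.Surjective g) (h : f.ker = g.ker) :
    Nonempty (L' ≃ₗ⁅k⁆ M') := by
  obtain ⟨e⟩ := nonempty_quotKer_lieEquiv f hf
  obtain ⟨e'⟩ := nonempty_quotKer_lieEquiv g hg
  rw [h] at e
  exact ⟨e.symm.trans e'⟩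

/-- The projection of `L` onto the kernel of `r` along the image of a section `s` of `r`, when this
image commutes with the kernel. -/
def kerProj (r : L →ₗ⁅k⁆ M) (s : M →ₗ⁅k⁆ L) (hrs : ∀ m, r (s m) = m)
    (hs : ∀ m, ∀ x ∈ r.ker, ⁅s m, x⁆ = 0) : L →ₗ⁅k⁆ r.ker where
  toFun x := ⟨x - s (r x), by simp [hrs]⟩
  map_add' x y := Subtype.ext <| by simp [add_sub_add_comm]
  map_smul' c x := Subtype.ext <| by simp [smul_sub]
  map_lie' {x y} := Subtype.ext <| by
    have lie_section (x y : L) : ⁅s (r x), y⁆ = ⁅s (r x), s (r y)⁆ := by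
      rw [← sub_eq_zero, ← lie_sub]
      exact hs _ _ (by simp [hrs])
    have section_lie : ⁅x, s (r y)⁆ = ⁅s (r x), s (r y)⁆ := by
      rw [← lie_skew, lie_section, lie_skew]
    simp [lie_section x y, section_lie, lie_sub, sub_lie]

/-- The endomorphism `x ↦ x - κ (r x)` of `L`, for a linear map `κ` with central values that
vanishes on brackets. -/
def shear (r : L →ₗ⁅k⁆ M) (κ : M →ₗ[k] L) (hκ : ∀ m (x : L), ⁅κ m, x⁆ = 0)
    (hκ' : ∀ m m' : M, κ ⁅m, m'⁆ = 0) : L →ₗ⁅k⁆ L where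
  toFun x := x - κ (r x)
  map_add' x y := by simp [add_sub_add_comm]
  map_smul' c x := by simp [smul_sub]
  map_lie' {x y} := by
    have hκ_right : ⁅x, κ (r y)⁆ = 0 := by rw [← lie_skew, hκ, neg_zero]
    simp [hκ, hκ', hκ_right, lie_sub, sub_lie]

theorem nonempty_lieEquiv_prod (r : L →ₗ⁅k⁆ M) (s : M →ₗ⁅k⁆ L) (κ : M →ₗ[k] L)
    (hrs : ∀ m, r (s m) = m) (hs : ∀ m, ∀ x ∈ r.ker, ⁅s m, x⁆ = 0)
    (hκ : ∀ m (x : L), ⁅κ m, x⁆ = 0) (hκ' : ∀ m m' : M, κ ⁅m, m'⁆ = 0)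
    (pL : L →ₗ⁅k⁆ L') (pM : M →ₗ⁅k⁆ M') (pK : r.ker →ₗ⁅k⁆ K')
    (hpL : Function.Surjective pL) (hpM : Function.Surjective pM) (hpK : Function.Surjective pK)
    (hpM_zero : ∀ m, pM m = 0 ↔ ∃ x, pL x = 0 ∧ r x = m)
    (hpK_zero : ∀ x : r.ker, pK x = 0 ↔ pL x = 0)
    (hpκ : ∀ m, pL (κ m) = 0) (hrκ : ∀ x, pL x = 0 → r (κ (r x)) = r x) :
    Nonempty (L' ≃ₗ⁅k⁆ M' × K') := by
  let q : L →ₗ⁅k⁆ r.ker := (kerProj r s hrs hs).comp (shear r κ hκ hκ')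
  have q_apply (x : L) : (q x : L) = x - κ (r x) - s (r (x - κ (r x))) := rfl
  refine nonempty_lieEquiv_of_ker_eq pL ((pM.comp r).prod (pK.comp q)) hpL ?_ ?_
  · rintro ⟨m', x'⟩
    obtain ⟨m, rfl⟩ := hpM m'
    obtain ⟨x, rfl⟩ := hpK x'
    have hx : r x = 0 := x.2
    refine ⟨s m + x + κ m - s (r (κ m)), Prod.ext ?_ ?_⟩
    · simp [hrs, hx]
    · refine congrArg pK (Subtype.ext ((q_apply _).trans ?_))
      simp only [map_add, map_sub, hrs, hx, add_zero, add_sub_cancel_right]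
      abel
  · ext x
    have q_of_eq (hx : r (κ (r x)) = r x) : pL (q x) = pL x := by
      rw [q_apply]
      simp [hx, hpκ]
    change pL x = 0 ↔ (pM (r x), pK (q x)) = 0
    rw [Prod.mk_eq_zero, hpM_zero, hpK_zero]
    constructor
    · intro hx
      exact ⟨⟨x, hx, rfl⟩, (q_of_eq (hrκ x hx)).trans hx⟩
    · rintro ⟨⟨y, hy, hyx⟩, hx⟩
      rwa [q_of_eq (hyx ▸ hrκ y hy)] at hx

end SplitExtension

theorem exists_linearMap_apply_comp_eq {k E M F : Type*} [Field k] [AddCommGroup E] [Module k E]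
    [AddCommGroup M] [Module k M] [AddCommGroup F] [Module k F] (α : E →ₗ[k] M) (T : M →ₗ[k] F)
    (h : ∀ c, T (α c) = 0 → α c = 0) :
    ∃ φ : F →ₗ[k] E, ∀ c, α (φ (T (α c))) = α c := by
  have hT : LinearMap.ker (T.domRestrict (LinearMap.range α)) = ⊥ := by
    rw [LinearMap.ker_eq_bot']
    rintro ⟨_, c, rfl⟩ hc
    exact Subtype.ext (h c hc)
  obtain ⟨σ, hσ⟩ := LinearMap.exists_leftInverse_of_injective _ hT
  obtain ⟨τ, hτ⟩ := α.rangeRestrict.exists_rightInverse_of_surjective α.range_rangeRestrict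
  refine ⟨τ ∘ₗ σ, fun c => ?_⟩
  have hστ : σ (T (α c)) = α.rangeRestrict c := LinearMap.congr_fun hσ (α.rangeRestrict c)
  rw [LinearMap.comp_apply, hστ]
  exact congrArg Subtype.val (LinearMap.congr_fun hτ (α.rangeRestrict c))

/-! ### Paths -/

namespace QPath

variable {V : Type w} {Q : Quiver.{v} V}

@[elab_as_elim]
theorem induction {motive : QPath Q → Prop} (idem : ∀ i, motive (idem Q i))
    (arrow_comp : ∀ {i j : V} (a : Q.Hom i j) (p : QPath Q) (h : p.tgt = (arrow a).src),
      motive p → motive ((arrow a).comp p h)) (p : QPath Q) : motive p := by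
  obtain ⟨i, j, p⟩ := p
  induction p with
  | nil => exact idem i
  | cons p a ih => exact arrow_comp a ⟨_, _, p⟩ rfl ih

theorem length_comp (p q : QPath Q) (h : q.tgt = p.src) :
    (p.comp q h).length = p.length + q.length := by
  obtain ⟨i, j, p⟩ := p
  obtain ⟨l, m, q⟩ := q
  dsimp only at h
  subst h
  exact (@Quiver.Path.length_comp V Q _ _ q _ p).trans (add_comm _ _)

theorem length_arrow_comp {i j : V} (a : Q.Hom i j) (p : QPath Q) (h : p.tgt = (arrow a).src) :
    ((arrow a).comp p h).length = p.length + 1 :=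
  (length_comp _ p h).trans (add_comm _ _)

theorem eq_idem_of_length_eq_zero {p : QPath Q} (hp : p.length = 0) : ∃ i, p = idem Q i := by
  induction p using QPath.induction with
  | idem i => exact ⟨i, rfl⟩
  | arrow_comp a p h _ => rw [length_arrow_comp] at hp; omega

end QPath

/-! ### Homomorphisms out of a monomial algebra -/

/-- Values of the vertices and arrows of `Q` in a ring `R` that satisfy the relations of the path
algebra: an arrow `i → j` goes to an element `x` with `x = e_j x e_i`, as paths are composed from
right to left. -/
structure QuiverRep {V : Type w} [Fintype V] (Q : Quiver.{v} V) (R : Type*) [Semiring R] where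
  vertex : V → R
  arrow : ∀ {i j : V}, Q.Hom i j → R
  complete : CompleteOrthogonalIdempotents vertex
  vertex_mul_arrow : ∀ {i j : V} (a : Q.Hom i j), vertex j * arrow a = arrow a
  arrow_mul_vertex : ∀ {i j : V} (a : Q.Hom i j), arrow a * vertex i = arrow a

namespace QuiverRep

variable {V : Type w} [Fintype V] {Q : Quiver.{v} V} {R : Type*} [Semiring R] (ρ : QuiverRep Q R)

/-- The product of the values of the arrows of a path with given endpoints; the value of the
vertex at its source for the path without arrows. -/
def evalAux {i : V} : ∀ {j : V}, @Quiver.Path V Q i j → R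
  | _, @Quiver.Path.nil _ _ _ => ρ.vertex i
  | _, @Quiver.Path.cons _ _ _ _ _ p a => ρ.arrow a * evalAux p

/-- The product of the values of the arrows of a path. -/
def eval (p : QPath Q) : R := ρ.evalAux p.path

theorem eval_idem (i : V) : ρ.eval (QPath.idem Q i) = ρ.vertex i := rfl

theorem eval_arrow {i j : V} (a : Q.Hom i j) : ρ.eval (QPath.arrow a) = ρ.arrow a :=
  ρ.arrow_mul_vertex a

theorem eval_arrow_comp {i j : V} (a : Q.Hom i j) (p : QPath Q)
    (h : p.tgt = (QPath.arrow a).src) :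
    ρ.eval ((QPath.arrow a).comp p h) = ρ.arrow a * ρ.eval p := by
  obtain ⟨l, m, p⟩ := p
  obtain rfl : m = i := h
  rfl

theorem vertex_mul_eval (p : QPath Q) : ρ.vertex p.tgt * ρ.eval p = ρ.eval p := by
  induction p using QPath.induction with
  | idem i => exact ρ.complete.idem i
  | arrow_comp a p h _ =>
    rw [eval_arrow_comp, ← mul_assoc]
    exact congrArg (· * ρ.eval p) (ρ.vertex_mul_arrow a)

theorem eval_mul_vertex (p : QPath Q) : ρ.eval p * ρ.vertex p.src = ρ.eval p := by
  induction p using QPath.induction with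
  | idem i => exact ρ.complete.idem i
  | arrow_comp a p h ih =>
    rw [eval_arrow_comp, mul_assoc]
    exact congrArg (ρ.arrow a * ·) ih

theorem eval_comp (p q : QPath Q) (h : q.tgt = p.src) :
    ρ.eval (p.comp q h) = ρ.eval p * ρ.eval q := by
  induction p using QPath.induction with
  | idem i =>
    have hq : ρ.vertex i * ρ.eval q = ρ.eval q := by
      rw [← show q.tgt = i from h, ρ.vertex_mul_eval]
    exact (congrArg ρ.eval (QPath.idem_comp q i h)).trans hq.symm
  | arrow_comp a p hp ih =>
    calc ρ.eval (((QPath.arrow a).comp p hp).comp q h)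
        = ρ.eval ((QPath.arrow a).comp (p.comp q h) hp) :=
          congrArg ρ.eval (QPath.comp_assoc _ _ _ hp h)
      _ = ρ.arrow a * (ρ.eval p * ρ.eval q) := by
          rw [← ih h]
          exact ρ.eval_arrow_comp a (p.comp q h) hp
      _ = ρ.eval ((QPath.arrow a).comp p hp) * ρ.eval q := by
          rw [eval_arrow_comp, mul_assoc]

theorem eval_mul_eval_of_ne {p q : QPath Q} (h : q.tgt ≠ p.src) : ρ.eval p * ρ.eval q = 0 := by
  rw [← ρ.eval_mul_vertex p, ← ρ.vertex_mul_eval q, mul_assoc, ← mul_assoc (ρ.vertex _),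
    ρ.complete.ortho h.symm, zero_mul, mul_zero]

end QuiverRep

section Lift

variable {k : Type u} [Field k] {V : Type w} [DecidableEq V] [Fintype V] {Q : Quiver.{v} V}
  {R : Type*} [Ring R] [Algebra k R] (ρ : QuiverRep Q R)

namespace PathAlgebra

theorem of_mul_of (p q : QPath Q) : of k p * of k q = mulPath k p q :=
  mulHom_of p q

/-- The homomorphism from the path algebra with given values of the vertices and arrows. -/
def lift : PathAlgebra k Q →ₐ[k] R :=
  AlgHom.ofLinearMap (extend k ρ.eval)
    (by simp only [one_def, map_sum, extend_of, QuiverRep.eval_idem, ρ.complete.complete])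
    (by
      intro x y
      have compr_mul_eq : (mulHom k Q).compr₂ (extend k ρ.eval) =
          (LinearMap.mul k R).compl₁₂ (extend k ρ.eval) (extend k ρ.eval) := by
        refine hom_ext fun p => hom_ext fun q => ?_
        simp only [LinearMap.compr₂_apply, LinearMap.compl₁₂_apply, mulHom_of, extend_of,
          LinearMap.mul_apply', mulPath]
        by_cases h : q.tgt = p.src
        · rw [dif_pos h, extend_of, ρ.eval_comp]
        · rw [dif_neg h, map_zero, ρ.eval_mul_eval_of_ne h]
      exact congr($compr_mul_eq x y))

theorem lift_of (p : QPath Q) : lift ρ (of k p) = ρ.eval p :=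
  extend_of _ p

end PathAlgebra

namespace MonomialAlgebra

variable {Z : Set (QPath Q)}

/-- The homomorphism from a monomial algebra with given values of the vertices and arrows. -/
def lift (hρ : ∀ z ∈ Z, ρ.eval z = 0) : MonomialAlgebra k Z →ₐ[k] R :=
  Ideal.Quotient.liftₐ (relIdeal k Z) (PathAlgebra.lift ρ) fun x hx => by
    have span_le : TwoSidedIdeal.span (PathAlgebra.of k '' Z) ≤
        TwoSidedIdeal.ker (PathAlgebra.lift (k := k) ρ) := by
      rw [TwoSidedIdeal.span_le]
      rintro _ ⟨z, hz, rfl⟩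
      exact (TwoSidedIdeal.mem_ker _).2 ((PathAlgebra.lift_of ρ z).trans (hρ z hz))
    exact (TwoSidedIdeal.mem_ker _).1 (span_le (TwoSidedIdeal.mem_asIdeal.1 hx))

end MonomialAlgebra

end Lift

/-! ### Residue classes of paths -/

section Classes

variable (k : Type u) [Field k] {V : Type w} [DecidableEq V] [Fintype V] {Q : Quiver.{v} V}
  (Z : Set (QPath Q))

/-- The residue class of a path in a monomial algebra. -/
def pathClass (p : QPath Q) : MonomialAlgebra k Z :=
  Ideal.Quotient.mk (relIdeal k Z) (PathAlgebra.of k p)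

/-- The idempotent of a vertex in a monomial algebra. -/
def vertexClass (i : V) : MonomialAlgebra k Z := pathClass k Z (QPath.idem Q i)

/-- The residue class of an arrow in a monomial algebra. -/
def arrowClass {i j : V} (a : Q.Hom i j) : MonomialAlgebra k Z := pathClass k Z (QPath.arrow a)

variable {k Z}

theorem pathClass_eq_zero {p : QPath Q} (hp : p ∈ Z) : pathClass k Z p = 0 :=
  Ideal.Quotient.eq_zero_iff_mem.2
    (TwoSidedIdeal.mem_asIdeal.2 (TwoSidedIdeal.subset_span ⟨p, hp, rfl⟩))

theorem pathClass_comp (p q : QPath Q) (h : q.tgt = p.src) :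
    pathClass k Z (p.comp q h) = pathClass k Z p * pathClass k Z q := by
  rw [pathClass, pathClass, pathClass, ← map_mul, PathAlgebra.of_mul_of, PathAlgebra.mulPath,
    dif_pos h]

theorem pathClass_mul_of_ne {p q : QPath Q} (h : q.tgt ≠ p.src) :
    pathClass k Z p * pathClass k Z q = 0 := by
  rw [pathClass, pathClass, ← map_mul, PathAlgebra.of_mul_of, PathAlgebra.mulPath, dif_neg h,
    map_zero]

theorem vertexClass_mul_pathClass (p : QPath Q) :
    vertexClass k Z p.tgt * pathClass k Z p = pathClass k Z p := by
  rw [vertexClass, ← pathClass_comp _ _ rfl]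
  exact congrArg (pathClass k Z) (QPath.idem_comp p _ rfl)

theorem pathClass_mul_vertexClass (p : QPath Q) :
    pathClass k Z p * vertexClass k Z p.src = pathClass k Z p := by
  rw [vertexClass, ← pathClass_comp _ _ rfl]
  exact congrArg (pathClass k Z) (QPath.comp_idem p _ rfl)

theorem vertexClass_mul_arrowClass {i j : V} (a : Q.Hom i j) :
    vertexClass k Z j * arrowClass k Z a = arrowClass k Z a :=
  vertexClass_mul_pathClass (QPath.arrow a)

theorem arrowClass_mul_vertexClass {i j : V} (a : Q.Hom i j) :
    arrowClass k Z a * vertexClass k Z i = arrowClass k Z a :=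
  pathClass_mul_vertexClass (QPath.arrow a)

theorem vertexClass_complete : CompleteOrthogonalIdempotents (vertexClass k Z) where
  idem i := vertexClass_mul_pathClass (QPath.idem Q i)
  ortho _ _ h := pathClass_mul_of_ne h.symm
  complete := by
    rw [← map_one (Ideal.Quotient.mk (relIdeal k Z)), PathAlgebra.one_def, map_sum]
    rfl

variable (k Z) in
/-- The vertices and arrows of `Q` as elements of the monomial algebra. -/
def classRep : QuiverRep Q (MonomialAlgebra k Z) where
  vertex := vertexClass k Z
  arrow a := arrowClass k Z a
  complete := vertexClass_complete
  vertex_mul_arrow := vertexClass_mul_arrowClass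
  arrow_mul_vertex := arrowClass_mul_vertexClass

theorem eval_classRep (p : QPath Q) : (classRep k Z).eval p = pathClass k Z p := by
  induction p using QPath.induction with
  | idem i => rfl
  | arrow_comp a p h ih =>
    rw [QuiverRep.eval_arrow_comp, ih, pathClass_comp]
    rfl

namespace MonomialAlgebra

theorem lift_pathClass {R : Type*} [Ring R] [Algebra k R] (ρ : QuiverRep Q R)
    (hρ : ∀ z ∈ Z, ρ.eval z = 0) (p : QPath Q) : lift ρ hρ (pathClass k Z p) = ρ.eval p :=
  PathAlgebra.lift_of ρ p

theorem linearMap_ext {M : Type*} [AddCommGroup M] [Module k M]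
    {f g : MonomialAlgebra k Z →ₗ[k] M} (h : ∀ p, f (pathClass k Z p) = g (pathClass k Z p)) :
    f = g := by
  have h_mk : f ∘ₗ (Ideal.Quotient.mkₐ k (relIdeal k Z)).toLinearMap =
      g ∘ₗ (Ideal.Quotient.mkₐ k (relIdeal k Z)).toLinearMap := PathAlgebra.hom_ext h
  refine LinearMap.ext fun x => ?_
  obtain ⟨x, rfl⟩ := Ideal.Quotient.mk_surjective x
  exact congr($h_mk x)

end MonomialAlgebra

/-! ### The length grading -/

theorem pathClass_mem_lengthGrading (p : QPath Q) :
    pathClass k Z p ∈ lengthGrading k Z p.length :=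
  Submodule.subset_span ⟨p, rfl, rfl⟩

theorem lengthGrading_le_iff {n : ℕ} {S : Submodule k (MonomialAlgebra k Z)} :
    lengthGrading k Z n ≤ S ↔ ∀ p : QPath Q, p.length = n → pathClass k Z p ∈ S := by
  rw [lengthGrading, Submodule.span_le, Set.image_subset_iff]
  rfl

instance : SetLike.GradedMonoid (lengthGrading k Z) where
  one_mem := by
    rw [← vertexClass_complete.complete]
    exact sum_mem fun i _ => pathClass_mem_lengthGrading (QPath.idem Q i)
  mul_mem := by
    intro m n x y hx hy
    have mul_le : lengthGrading k Z m * lengthGrading k Z n ≤ lengthGrading k Z (m + n) := by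
      rw [lengthGrading, lengthGrading, Submodule.span_mul_span, Submodule.span_le]
      rintro _ ⟨_, ⟨p, rfl, rfl⟩, _, ⟨q, rfl, rfl⟩, rfl⟩
      change pathClass k Z p * pathClass k Z q ∈ lengthGrading k Z (p.length + q.length)
      by_cases h : q.tgt = p.src
      · rw [← pathClass_comp p q h, ← QPath.length_comp p q h]
        exact pathClass_mem_lengthGrading _
      · rw [pathClass_mul_of_ne h]
        exact zero_mem _
    exact mul_le (Submodule.mul_mem_mul hx hy)

variable (k Z) in
/-- The residue class of a path as a homogeneous element. -/
def homogeneousClass (p : QPath Q) : DirectSum ℕ fun n => lengthGrading k Z n :=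
  DirectSum.of (fun n => lengthGrading k Z n) p.length
    ⟨pathClass k Z p, pathClass_mem_lengthGrading p⟩

theorem homogeneousClass_comp (p q : QPath Q) (h : q.tgt = p.src) :
    homogeneousClass k Z (p.comp q h) = homogeneousClass k Z p * homogeneousClass k Z q := by
  rw [homogeneousClass, homogeneousClass, homogeneousClass, DirectSum.of_mul_of]
  exact DirectSum.of_eq_of_gradedMonoid_eq
    (Sigma.subtype_ext (QPath.length_comp p q h) (pathClass_comp p q h))

theorem homogeneousClass_eq_zero {p : QPath Q} (hp : pathClass k Z p = 0) :
    homogeneousClass k Z p = 0 :=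
  (congrArg (DirectSum.of (fun n => lengthGrading k Z n) _) (Subtype.ext hp)).trans (map_zero _)

theorem homogeneousClass_mul_of_ne {p q : QPath Q} (h : q.tgt ≠ p.src) :
    homogeneousClass k Z p * homogeneousClass k Z q = 0 := by
  rw [homogeneousClass, homogeneousClass, DirectSum.of_mul_of]
  exact (congrArg (DirectSum.of (fun n => lengthGrading k Z n) _)
    (Subtype.ext (pathClass_mul_of_ne h))).trans (map_zero _)

theorem sum_homogeneousClass_idem : ∑ i, homogeneousClass k Z (QPath.idem Q i) = 1 := by
  refine (map_sum (DirectSum.of (fun n => lengthGrading k Z n) 0) _ _).symm.trans ?_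
  refine congrArg (DirectSum.of (fun n => lengthGrading k Z n) 0) (Subtype.ext ?_)
  exact (AddSubmonoidClass.coe_finsetSum _ _).trans vertexClass_complete.complete

variable (k Z) in
/-- The vertices and arrows of `Q` as homogeneous elements. -/
def homogeneousRep : QuiverRep Q (DirectSum ℕ fun n => lengthGrading k Z n) where
  vertex i := homogeneousClass k Z (QPath.idem Q i)
  arrow a := homogeneousClass k Z (QPath.arrow a)
  complete :=
    { idem i := by
        rw [IsIdempotentElem, ← homogeneousClass_comp _ _ rfl]
        exact congrArg (homogeneousClass k Z) (QPath.idem_comp _ _ rfl)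
      ortho _ _ h := homogeneousClass_mul_of_ne h.symm
      complete := sum_homogeneousClass_idem }
  vertex_mul_arrow a := by
    rw [← homogeneousClass_comp _ _ rfl]
    exact congrArg (homogeneousClass k Z) (QPath.idem_comp _ _ rfl)
  arrow_mul_vertex a := by
    rw [← homogeneousClass_comp _ _ rfl]
    exact congrArg (homogeneousClass k Z) (QPath.comp_idem _ _ rfl)

theorem eval_homogeneousRep (p : QPath Q) :
    (homogeneousRep k Z).eval p = homogeneousClass k Z p := by
  induction p using QPath.induction with
  | idem i => rfl
  | arrow_comp a p h ih =>
    rw [QuiverRep.eval_arrow_comp, ih, homogeneousClass_comp]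
    rfl

variable (k Z) in
/-- The decomposition of a monomial algebra into its components. -/
def decomposeHom : MonomialAlgebra k Z →ₐ[k] DirectSum ℕ fun n => lengthGrading k Z n :=
  MonomialAlgebra.lift (R := DirectSum ℕ fun n => lengthGrading k Z n) (homogeneousRep k Z)
    fun z hz => by
      rw [eval_homogeneousRep, homogeneousClass_eq_zero (pathClass_eq_zero hz)]

theorem decomposeHom_pathClass (p : QPath Q) :
    decomposeHom k Z (pathClass k Z p) = homogeneousClass k Z p := by
  rw [decomposeHom, MonomialAlgebra.lift_pathClass, eval_homogeneousRep]

instance : GradedAlgebra (lengthGrading k Z) :=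
  GradedAlgebra.ofAlgHom (lengthGrading k Z) (decomposeHom k Z)
    (by
      refine AlgHom.toLinearMap_injective (MonomialAlgebra.linearMap_ext fun p => ?_)
      simp only [AlgHom.toLinearMap_apply, AlgHom.comp_apply, decomposeHom_pathClass,
        homogeneousClass, DirectSum.coeAlgHom_of, AlgHom.id_apply])
    (by
      rintro n ⟨x, hx⟩
      induction hx using Submodule.span_induction with
      | mem x hx =>
        obtain ⟨p, rfl, rfl⟩ := hx
        exact decomposeHom_pathClass p
      | zero => exact (map_zero _).trans (map_zero _).symm
      | add x y hx hy ihx ihy =>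
        exact (map_add _ x y).trans ((congrArg₂ (· + ·) ihx ihy).trans (map_add _ _ _).symm)
      | smul c x hx ih =>
        refine (map_smul _ c x).trans ((congrArg (c • ·) ih).trans ?_)
        exact (DirectSum.of_smul (M := fun n => lengthGrading k Z n) k n c ⟨x, hx⟩).symm)

end Classes

/-! ### Derivations -/

section Derivations

variable {k : Type u} [Field k] {A : Type*} [Ring A] [Algebra k A]

theorem ad_apply (x y : A) : ad k x y = x * y - y * x := rfl

theorem ad_zero : ad k (0 : A) = 0 := by
  ext y
  simp [ad_apply]

theorem ad_mem_derivations (x : A) : ad k x ∈ derivations k A := by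
  intro y z
  simp only [ad_apply, sub_mul, mul_sub, mul_assoc]
  abel

theorem derivation_apply_mul {f : Module.End k A} (hf : f ∈ derivations k A) (x y : A) :
    f (x * y) = f x * y + x * f y :=
  hf x y

theorem derivation_apply_eq_zero_of_commute {f : Module.End k A} (hf : f ∈ derivations k A) {e : A}
    (he : IsIdempotentElem e) (hc : Commute e (f e)) : f e = 0 := by
  have apply_e : f e = e * f e + e * f e := by
    conv_lhs => rw [← he.eq, derivation_apply_mul hf, ← hc.eq]
  have mul_apply_e : e * f e = e * f e + e * f e := by
    conv_lhs => rw [apply_e, mul_add, ← mul_assoc, he.eq]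
  rw [apply_e, left_eq_add.1 mul_apply_e, add_zero]

theorem ad_eq_ad_decompose_zero (𝒜 : ℕ → Submodule k A) [GradedAlgebra 𝒜] {x : A}
    (hx : ad k x ∈ degreePreserving k 𝒜) : ad k x = ad k (DirectSum.decompose 𝒜 x 0 : A) := by
  refine DirectSum.decompose_lhom_ext 𝒜 fun n => LinearMap.ext fun y => ?_
  have coe_decompose : (DirectSum.decompose 𝒜 (ad k x y) n : A) = ad k x y :=
    DirectSum.decompose_of_mem_same 𝒜 (hx n y y.2)
  have hxy := DirectSum.coe_decompose_mul_add_of_right_mem 𝒜 (a := x) (i := 0) y.2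
  have hyx := DirectSum.coe_decompose_mul_add_of_left_mem 𝒜 (b := x) (j := 0) y.2
  rw [zero_add] at hxy
  rw [add_zero] at hyx
  calc ad k x y = (DirectSum.decompose 𝒜 (x * y - y * x) n : A) := coe_decompose.symm
    _ = ad k (DirectSum.decompose 𝒜 x 0 : A) y := by
      rw [DirectSum.decompose_sub, DirectSum.sub_apply, Submodule.coe_sub, hxy, hyx, ad_apply]

end Derivations

namespace QPath

variable {V : Type w} {Q : Quiver.{v} V}

theorem exists_eq_arrow_of_length_eq_one {p : QPath Q} (hp : p.length = 1) :
    ∃ (i j : V) (a : Q.Hom i j), p = arrow a := by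
  induction p using QPath.induction with
  | idem i => exact absurd hp zero_ne_one
  | @arrow_comp i j a p h _ =>
    rw [length_arrow_comp] at hp
    obtain ⟨l, rfl⟩ := eq_idem_of_length_eq_zero (Nat.succ_injective hp)
    exact ⟨i, j, a, comp_idem _ l h⟩

end QPath

section GradedDer

variable {k : Type u} [Field k] {V : Type w} [DecidableEq V] [Fintype V] {Q : Quiver.{v} V}
  {Z : Set (QPath Q)}

variable (k Z) in
/-- The combination of the vertices with given coefficients. -/
def diag : (V → k) →ₗ[k] MonomialAlgebra k Z :=
  Fintype.linearCombination k (vertexClass k Z)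

theorem diag_mul_pathClass (c : V → k) (p : QPath Q) :
    diag k Z c * pathClass k Z p = c p.tgt • pathClass k Z p := by
  rw [diag, Fintype.linearCombination_apply, Finset.sum_mul, Finset.sum_eq_single p.tgt]
  · rw [smul_mul_assoc, vertexClass_mul_pathClass]
  · intro i _ hi
    rw [smul_mul_assoc, vertexClass, pathClass_mul_of_ne (Ne.symm hi), smul_zero]
  · simp

theorem pathClass_mul_diag (c : V → k) (p : QPath Q) :
    pathClass k Z p * diag k Z c = c p.src • pathClass k Z p := by
  rw [diag, Fintype.linearCombination_apply, Finset.mul_sum, Finset.sum_eq_single p.src]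
  · rw [mul_smul_comm, pathClass_mul_vertexClass]
  · intro i _ hi
    rw [mul_smul_comm, vertexClass, pathClass_mul_of_ne hi, smul_zero]
  · simp

theorem ad_diag_pathClass (c : V → k) (p : QPath Q) :
    ad k (diag k Z c) (pathClass k Z p) = (c p.tgt - c p.src) • pathClass k Z p := by
  rw [ad_apply, diag_mul_pathClass, pathClass_mul_diag, sub_smul]

theorem exists_diag_eq {x : MonomialAlgebra k Z} (hx : x ∈ lengthGrading k Z 0) :
    ∃ c, diag k Z c = x := by
  have lengthGrading_le : lengthGrading k Z 0 ≤ LinearMap.range (diag k Z) := by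
    refine lengthGrading_le_iff.2 fun p hp => ?_
    obtain ⟨i, rfl⟩ := QPath.eq_idem_of_length_eq_zero hp
    exact ⟨Pi.single i 1, by
      rw [diag, Fintype.linearCombination_apply_single, one_smul, vertexClass]⟩
  exact lengthGrading_le hx

variable (k Z) in
/-- The span of the classes of the arrows from `i` to `j`. -/
def arrowSpan (i j : V) : Submodule k (MonomialAlgebra k Z) :=
  Submodule.span k (Set.range fun a : Q.Hom i j => arrowClass k Z a)

instance (i j : V) [Finite (Q.Hom i j)] : Module.Finite k (arrowSpan k Z i j) :=
  FiniteDimensional.span_of_finite k (Set.finite_range _)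

theorem arrowClass_mem_arrowSpan {i j : V} (a : Q.Hom i j) :
    arrowClass k Z a ∈ arrowSpan k Z i j :=
  Submodule.subset_span ⟨a, rfl⟩

theorem arrowSpan_le_iff {i j : V} {S : Submodule k (MonomialAlgebra k Z)} :
    arrowSpan k Z i j ≤ S ↔ ∀ a : Q.Hom i j, arrowClass k Z a ∈ S := by
  rw [arrowSpan, Submodule.span_le, Set.range_subset_iff]
  rfl

theorem arrowSpan_le_lengthGrading {i j : V} : arrowSpan k Z i j ≤ lengthGrading k Z 1 :=
  arrowSpan_le_iff.2 fun a => pathClass_mem_lengthGrading (QPath.arrow a)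

theorem vertexClass_mul_mul_vertexClass_mem_arrowSpan {x : MonomialAlgebra k Z}
    (hx : x ∈ lengthGrading k Z 1) (i j : V) :
    vertexClass k Z j * x * vertexClass k Z i ∈ arrowSpan k Z i j := by
  have lengthGrading_le : lengthGrading k Z 1 ≤ (arrowSpan k Z i j).comap
      (LinearMap.mulLeftRight k (vertexClass k Z j, vertexClass k Z i)) := by
    refine lengthGrading_le_iff.2 fun p hp => ?_
    obtain ⟨s, t, a, rfl⟩ := QPath.exists_eq_arrow_of_length_eq_one hp
    change vertexClass k Z j * arrowClass k Z a * vertexClass k Z i ∈ arrowSpan k Z i j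
    by_cases ht : t = j
    · subst ht
      rw [vertexClass_mul_arrowClass]
      by_cases hs : s = i
      · subst hs
        rw [arrowClass_mul_vertexClass]
        exact arrowClass_mem_arrowSpan a
      · rw [arrowClass, vertexClass, pathClass_mul_of_ne (Ne.symm hs)]
        exact zero_mem _
    · rw [arrowClass, vertexClass, pathClass_mul_of_ne ht, zero_mul]
      exact zero_mem _
  exact lengthGrading_le hx

/-! ### Derivations of degree zero of a monomial algebra -/

variable (k Z) in
/-- The Lie algebra of derivations of a monomial algebra that preserve the path length. -/
def gradedDer : LieSubalgebra k (Module.End k (MonomialAlgebra k Z)) :=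
  derivations k (MonomialAlgebra k Z) ⊓ degreePreserving k (lengthGrading k Z)

theorem gradedDer_apply_vertexClass (f : gradedDer k Z) (i : V) :
    f.1 (vertexClass k Z i) = 0 := by
  obtain ⟨c, hc⟩ := exists_diag_eq
    (f.2.2 0 _ (pathClass_mem_lengthGrading (QPath.idem Q i)))
  refine derivation_apply_eq_zero_of_commute f.2.1 (vertexClass_complete.idem i) ?_
  change vertexClass k Z i * f.1 (pathClass k Z (QPath.idem Q i)) =
    f.1 (pathClass k Z (QPath.idem Q i)) * vertexClass k Z i
  rw [← hc]
  exact (pathClass_mul_diag c _).trans (diag_mul_pathClass c _).symm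

theorem gradedDer_apply_arrowClass (f : gradedDer k Z) {i j : V} (a : Q.Hom i j) :
    f.1 (arrowClass k Z a) ∈ arrowSpan k Z i j := by
  have apply_eq : f.1 (arrowClass k Z a) =
      vertexClass k Z j * f.1 (arrowClass k Z a) * vertexClass k Z i := by
    conv_lhs => rw [← vertexClass_mul_arrowClass a, ← arrowClass_mul_vertexClass a]
    rw [derivation_apply_mul f.2.1, derivation_apply_mul f.2.1]
    simp [gradedDer_apply_vertexClass, mul_assoc]
  rw [apply_eq]
  exact vertexClass_mul_mul_vertexClass_mem_arrowSpan
    (f.2.2 1 _ (pathClass_mem_lengthGrading (QPath.arrow a))) i j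

theorem gradedDer_apply_mem_arrowSpan (f : gradedDer k Z) {i j : V} {x : MonomialAlgebra k Z}
    (hx : x ∈ arrowSpan k Z i j) : f.1 x ∈ arrowSpan k Z i j := by
  have arrowSpan_le : arrowSpan k Z i j ≤ (arrowSpan k Z i j).comap f.1 :=
    arrowSpan_le_iff.2 (gradedDer_apply_arrowClass f)
  exact arrowSpan_le hx

theorem gradedDer_ext {f g : gradedDer k Z}
    (h : ∀ {i j : V} (a : Q.Hom i j), f.1 (arrowClass k Z a) = g.1 (arrowClass k Z a)) :
    f = g := by
  refine Subtype.ext (MonomialAlgebra.linearMap_ext fun p => ?_)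
  induction p using QPath.induction with
  | idem i => exact (gradedDer_apply_vertexClass f i).trans (gradedDer_apply_vertexClass g i).symm
  | arrow_comp a p _ ih =>
    rw [pathClass_comp, derivation_apply_mul f.2.1, derivation_apply_mul g.2.1, ih]
    exact congrArg (· * pathClass k Z p + _) (h a)

theorem mem_gradedDer {f : Module.End k (MonomialAlgebra k Z)}
    (hf : f ∈ derivations k (MonomialAlgebra k Z)) (hvertex : ∀ i, f (vertexClass k Z i) = 0)
    (harrow : ∀ {i j : V} (a : Q.Hom i j), f (arrowClass k Z a) ∈ arrowSpan k Z i j) :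
    f ∈ gradedDer k Z := by
  have apply_pathClass_mem (p : QPath Q) : f (pathClass k Z p) ∈ lengthGrading k Z p.length := by
    induction p using QPath.induction with
    | idem i => exact (hvertex i).symm ▸ zero_mem _
    | arrow_comp a p h ih =>
      rw [pathClass_comp, derivation_apply_mul hf, QPath.length_arrow_comp, add_comm]
      exact add_mem
        (SetLike.mul_mem_graded (arrowSpan_le_lengthGrading (harrow a))
          (pathClass_mem_lengthGrading p))
        (SetLike.mul_mem_graded (pathClass_mem_lengthGrading (QPath.arrow a)) ih)
  refine ⟨hf, fun n x hx => ?_⟩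
  have lengthGrading_le : lengthGrading k Z n ≤ (lengthGrading k Z n).comap f := by
    refine lengthGrading_le_iff.2 ?_
    rintro p rfl
    exact apply_pathClass_mem p
  exact lengthGrading_le hx

theorem ad_diag_mem_gradedDer (c : V → k) : ad k (diag k Z c) ∈ gradedDer k Z := by
  refine mem_gradedDer (ad_mem_derivations _) (fun i => ?_) fun a => ?_
  · exact (ad_diag_pathClass c (QPath.idem Q i)).trans (smul_eq_zero_of_left (sub_self _) _)
  · exact (ad_diag_pathClass c _).symm ▸ Submodule.smul_mem _ _ (arrowClass_mem_arrowSpan a)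

variable (k Z) in
/-- The inner derivation given by a combination of vertices. -/
def adDiag : (V → k) →ₗ[k] gradedDer k Z where
  toFun c := ⟨ad k (diag k Z c), ad_diag_mem_gradedDer c⟩
  map_add' c d := Subtype.ext ((congrArg (ad k) (map_add _ c d)).trans (ad_add k _ _))
  map_smul' r c := Subtype.ext ((congrArg (ad k) (map_smul _ r c)).trans (ad_smul k _ _))

theorem adDiag_apply_arrowClass (c : V → k) {i j : V} (a : Q.Hom i j) :
    (adDiag k Z c).1 (arrowClass k Z a) = (c j - c i) • arrowClass k Z a :=
  ad_diag_pathClass c (QPath.arrow a)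

theorem adDiag_lie (c : V → k) (f : gradedDer k Z) : ⁅adDiag k Z c, f⁆ = 0 := by
  have apply_diag : f.1 (diag k Z c) = 0 := by
    simp [diag, Fintype.linearCombination_apply, gradedDer_apply_vertexClass]
  rw [← lie_skew, neg_eq_zero]
  refine Subtype.ext ((lie_ad k f.2.1 (diag k Z c)).trans ?_)
  rw [apply_diag, ad_zero]
  rfl

theorem exists_ad_eq_iff (f : gradedDer k Z) :
    (∃ x, f.1 = ad k x) ↔ ∃ c, adDiag k Z c = f := by
  constructor
  · rintro ⟨x, hx⟩
    obtain ⟨c, hc⟩ := exists_diag_eq (DirectSum.decompose (lengthGrading k Z) x 0).2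
    refine ⟨c, Subtype.ext ?_⟩
    rw [hx, ad_eq_ad_decompose_zero (lengthGrading k Z) (hx ▸ f.2.2), ← hc]
    rfl
  · rintro ⟨c, rfl⟩
    exact ⟨diag k Z c, rfl⟩

/-! ### Traces on the arrow spaces -/

variable (k Z) in
/-- The action of the derivations of degree zero on the span of the arrows from `i` to `j`. -/
def arrowAction (i j : V) : gradedDer k Z →ₗ⁅k⁆ Module.End k (arrowSpan k Z i j) where
  toFun f := f.1.restrict fun _ => gradedDer_apply_mem_arrowSpan f
  map_add' _ _ := rfl
  map_smul' _ _ := rfl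
  map_lie' := rfl

theorem arrowAction_adDiag (c : V → k) (i j : V) :
    arrowAction k Z i j (adDiag k Z c) = (c j - c i) • LinearMap.id := by
  have arrowSpan_le : arrowSpan k Z i j ≤
      LinearMap.eqLocus (adDiag k Z c).1 ((c j - c i) • LinearMap.id) :=
    arrowSpan_le_iff.2 (adDiag_apply_arrowClass c)
  exact LinearMap.ext fun x => Subtype.ext (arrowSpan_le x.2)

theorem smul_id_eq_zero_of_trace_eq_zero {E : Type*} [CharZero k] [AddCommGroup E] [Module k E]
    [Module.Finite k E] {c : k} (h : LinearMap.trace k E (c • LinearMap.id) = 0) :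
    c • (LinearMap.id : E →ₗ[k] E) = 0 := by
  rw [map_smul, LinearMap.trace_id, smul_eq_mul, mul_eq_zero, Nat.cast_eq_zero] at h
  rcases h with rfl | h
  · exact zero_smul k _
  · have : Subsingleton E := Module.finrank_zero_iff.1 h
    exact Subsingleton.elim _ _

variable (k Z) in
/-- The traces of a derivation of degree zero on the spans of parallel arrows. -/
def arrowTraces : gradedDer k Z →ₗ[k] (V × V → k) :=
  LinearMap.pi fun ij => LinearMap.trace k _ ∘ₗ (arrowAction k Z ij.1 ij.2).toLinearMap

theorem arrowTraces_lie (f g : gradedDer k Z) : arrowTraces k Z ⁅f, g⁆ = 0 := by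
  ext ij
  change LinearMap.trace k _ (arrowAction k Z ij.1 ij.2 ⁅f, g⁆) = 0
  rw [LieHom.map_lie, LinearMap.trace_lie]

theorem adDiag_eq_zero_of_arrowTraces_eq_zero [CharZero k] [∀ i j, Finite (Q.Hom i j)]
    {c : V → k} (h : arrowTraces k Z (adDiag k Z c) = 0) : adDiag k Z c = 0 := by
  refine gradedDer_ext fun {i j} a => ?_
  have trace_eq_zero : LinearMap.trace k _ (arrowAction k Z i j (adDiag k Z c)) = 0 :=
    congrFun h (i, j)
  rw [arrowAction_adDiag] at trace_eq_zero
  have action_eq_zero : arrowAction k Z i j (adDiag k Z c) = 0 :=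
    (arrowAction_adDiag c i j).trans (smul_id_eq_zero_of_trace_eq_zero trace_eq_zero)
  exact congrArg Subtype.val
    (LinearMap.congr_fun action_eq_zero ⟨_, arrowClass_mem_arrowSpan a⟩)

variable (k Z) in
theorem exists_retraction_adDiag [CharZero k] [∀ i j, Finite (Q.Hom i j)] :
    ∃ φ : gradedDer k Z →ₗ[k] (V → k),
      (∀ f g : gradedDer k Z, φ ⁅f, g⁆ = 0) ∧
        ∀ c, adDiag k Z (φ (adDiag k Z c)) = adDiag k Z c := by
  obtain ⟨φ, hφ⟩ := exists_linearMap_apply_comp_eq (adDiag k Z) (arrowTraces k Z)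
    fun _ => adDiag_eq_zero_of_arrowTraces_eq_zero
  refine ⟨φ ∘ₗ arrowTraces k Z, fun f g => ?_, hφ⟩
  rw [LinearMap.comp_apply, arrowTraces_lie, map_zero]

end GradedDer

/-! ### The projection of the dual extension onto `B` -/

namespace QPath

variable {V : Type w} {QB QA : Quiver.{v} V}

theorem opPath_arrow_comp {i j : V} (a : QA.Hom i j) (p : QPath QA)
    (h : p.tgt = (arrow a).src) :
    opPath QB QA ((arrow a).comp p h) =
      (opPath QB QA p).comp (arrow (opArrow QB QA i j a)) h.symm := by
  obtain ⟨l, m, p⟩ := p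
  obtain rfl : m = i := h
  rfl

end QPath

namespace QuiverRep

variable {V : Type w} [Fintype V] {Q Q' QB QA : Quiver.{v} V} {R : Type*} [Semiring R]

/-- The restriction of a system of values along a map of quivers which is the identity on
vertices. -/
def comap (ρ : QuiverRep Q' R) (φ : ∀ i j, Q.Hom i j → Q'.Hom i j) : QuiverRep Q R where
  vertex := ρ.vertex
  arrow a := ρ.arrow (φ _ _ a)
  complete := ρ.complete
  vertex_mul_arrow a := ρ.vertex_mul_arrow (φ _ _ a)
  arrow_mul_vertex a := ρ.arrow_mul_vertex (φ _ _ a)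

theorem eval_map (ρ : QuiverRep Q' R) (φ : ∀ i j, Q.Hom i j → Q'.Hom i j) (p : QPath Q) :
    ρ.eval (p.map φ) = (ρ.comap φ).eval p := by
  induction p using QPath.induction with
  | idem i => rfl
  | arrow_comp a p h ih =>
    rw [eval_arrow_comp, ← ih, QPath.map_comp]
    exact ρ.eval_arrow_comp _ (p.map φ) h

variable (ρ : QuiverRep (dualQuiver QB QA) R)

theorem eval_opPath_arrow_comp {i j : V} (a : QA.Hom i j) (p : QPath QA)
    (h : p.tgt = (QPath.arrow a).src) :
    ρ.eval (opPath QB QA ((QPath.arrow a).comp p h)) =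
      ρ.eval (opPath QB QA p) * ρ.arrow (opArrow QB QA i j a) := by
  rw [QPath.opPath_arrow_comp, ← ρ.eval_arrow]
  exact ρ.eval_comp (opPath QB QA p) (QPath.arrow (opArrow QB QA i j a)) h.symm

theorem eval_eq_zero_of_mem_dualRelations {ZB : Set (QPath QB)} {ZA : Set (QPath QA)}
    (hZB : ∀ z ∈ ZB, ρ.eval (z.map (inclArrow QB QA)) = 0)
    (hZA : ∀ z ∈ ZA, ρ.eval (opPath QB QA z) = 0)
    (hmul : ∀ {i j l : V} (b : QB.Hom j l) (a : QA.Hom j i),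
      ρ.arrow (inclArrow QB QA j l b) * ρ.arrow (opArrow QB QA j i a) = 0)
    {z : QPath (dualQuiver QB QA)} (hz : z ∈ dualRelations ZB ZA) : ρ.eval z = 0 := by
  obtain (⟨z, hz, rfl⟩ | ⟨z, hz, rfl⟩) | ⟨i, j, l, a, b, rfl⟩ := hz
  · exact hZB z hz
  · exact hZA z hz
  · exact (ρ.eval_arrow_comp _ _ rfl).trans
      ((congrArg (_ * ·) (ρ.eval_arrow _)).trans (hmul b a))

end QuiverRep

section Borel

variable {k : Type u} [Field k] {V : Type w} [DecidableEq V] [Fintype V] {QB QA : Quiver.{v} V}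
  {ZB : Set (QPath QB)} {ZA : Set (QPath QA)}

theorem borelHom_pathClass (p : QPath QB) :
    borelHom k ZB ZA (pathClass k ZB p) =
      pathClass k (dualRelations ZB ZA) (p.map (inclArrow QB QA)) :=
  congrArg (Ideal.Quotient.mk (relIdeal k (dualRelations ZB ZA))) (PathAlgebra.map_of _ p)

theorem borelHom_arrowClass {i j : V} (b : QB.Hom i j) :
    borelHom k ZB ZA (arrowClass k ZB b) =
      arrowClass k (dualRelations ZB ZA) (inclArrow QB QA i j b) :=
  borelHom_pathClass (QPath.arrow b)

theorem borelHom_vertexClass (i : V) :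
    borelHom k ZB ZA (vertexClass k ZB i) = vertexClass k (dualRelations ZB ZA) i :=
  borelHom_pathClass (QPath.idem QB i)

theorem arrowClass_inclArrow_mul_arrowClass_opArrow {i j l : V} (b : QB.Hom j l)
    (a : QA.Hom j i) :
    arrowClass k (dualRelations ZB ZA) (inclArrow QB QA j l b) *
      arrowClass k (dualRelations ZB ZA) (opArrow QB QA j i a) = 0 :=
  (pathClass_comp _ _ rfl).symm.trans (pathClass_eq_zero (Or.inr ⟨i, j, l, a, b, rfl⟩))

variable (k QA ZB) in
/-- The values of the vertices and arrows of the dual extension in `B` that send the arrows of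
`A` to zero. -/
def borelProjRep : QuiverRep (dualQuiver QB QA) (MonomialAlgebra k ZB) where
  vertex := vertexClass k ZB
  arrow := Sum.elim (fun b => arrowClass k ZB b) 0
  complete := vertexClass_complete
  vertex_mul_arrow
    | Sum.inl b => vertexClass_mul_arrowClass b
    | Sum.inr _ => mul_zero _
  arrow_mul_vertex
    | Sum.inl b => arrowClass_mul_vertexClass b
    | Sum.inr _ => zero_mul _

theorem eval_borelProjRep_map (p : QPath QB) :
    (borelProjRep k QA ZB).eval (p.map (inclArrow QB QA)) = pathClass k ZB p :=
  ((borelProjRep k QA ZB).eval_map _ p).trans (eval_classRep p)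

theorem eval_borelProjRep_opPath {p : QPath QA} (hp : p.length ≠ 0) :
    (borelProjRep k QA ZB).eval (opPath QB QA p) = 0 := by
  induction p using QPath.induction with
  | idem i => exact absurd rfl hp
  | arrow_comp a p h _ =>
    rw [QuiverRep.eval_opPath_arrow_comp]
    exact mul_zero _

/-- The projection of the dual extension onto `B` that sends the arrows of `A` to zero. -/
def borelProj (hZA : ∀ z ∈ ZA, z.length ≠ 0) : DualExtension k ZB ZA →ₐ[k] MonomialAlgebra k ZB :=
  MonomialAlgebra.lift (borelProjRep k QA ZB) fun _ =>
    QuiverRep.eval_eq_zero_of_mem_dualRelations _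
      (fun z hz => (eval_borelProjRep_map z).trans (pathClass_eq_zero hz))
      (fun z hz => eval_borelProjRep_opPath (hZA z hz))
      (fun _ _ => mul_zero _)

variable (hZA : ∀ z ∈ ZA, z.length ≠ 0)

theorem borelProj_arrowClass_inclArrow {i j : V} (b : QB.Hom i j) :
    borelProj hZA (arrowClass k (dualRelations ZB ZA) (inclArrow QB QA i j b)) =
      arrowClass k ZB b :=
  (MonomialAlgebra.lift_pathClass _ _ _).trans (QuiverRep.eval_arrow _ _)

theorem borelProj_arrowClass_opArrow {i j : V} (a : QA.Hom i j) :
    borelProj (ZB := ZB) hZA (arrowClass k (dualRelations ZB ZA) (opArrow QB QA i j a)) = 0 :=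
  (MonomialAlgebra.lift_pathClass _ _ _).trans (QuiverRep.eval_arrow _ _)

theorem borelProj_borelHom (x : MonomialAlgebra k ZB) : borelProj hZA (borelHom k ZB ZA x) = x := by
  have comp_eq_id : (borelProj hZA).toLinearMap ∘ₗ (borelHom k ZB ZA).toLinearMap =
      LinearMap.id := by
    refine MonomialAlgebra.linearMap_ext fun p => ?_
    change borelProj hZA (borelHom k ZB ZA (pathClass k ZB p)) = pathClass k ZB p
    rw [borelHom_pathClass, borelProj, MonomialAlgebra.lift_pathClass, eval_borelProjRep_map]
  exact LinearMap.congr_fun comp_eq_id x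

theorem borelProj_mem_arrowSpan {i j : V} {x : DualExtension k ZB ZA}
    (hx : x ∈ arrowSpan k (dualRelations ZB ZA) i j) : borelProj hZA x ∈ arrowSpan k ZB i j := by
  have arrowSpan_le : arrowSpan k (dualRelations ZB ZA) i j ≤
      (arrowSpan k ZB i j).comap (borelProj hZA).toLinearMap := by
    rw [arrowSpan_le_iff]
    rintro (b | a)
    · change borelProj hZA (arrowClass k (dualRelations ZB ZA) (inclArrow QB QA i j b)) ∈
        arrowSpan k ZB i j
      rw [borelProj_arrowClass_inclArrow]
      exact arrowClass_mem_arrowSpan b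
    · change borelProj hZA (arrowClass k (dualRelations ZB ZA) (opArrow QB QA j i a)) ∈
        arrowSpan k ZB i j
      rw [borelProj_arrowClass_opArrow]
      exact zero_mem _
  exact arrowSpan_le hx

theorem borelHom_mem_arrowSpan {i j : V} {x : MonomialAlgebra k ZB}
    (hx : x ∈ arrowSpan k ZB i j) :
    borelHom k ZB ZA x ∈ arrowSpan k (dualRelations ZB ZA) i j := by
  have arrowSpan_le : arrowSpan k ZB i j ≤
      (arrowSpan k (dualRelations ZB ZA) i j).comap (borelHom k ZB ZA).toLinearMap := by
    rw [arrowSpan_le_iff]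
    intro b
    change borelHom k ZB ZA (arrowClass k ZB b) ∈ arrowSpan k (dualRelations ZB ZA) i j
    rw [borelHom_arrowClass]
    exact arrowClass_mem_arrowSpan _
  exact arrowSpan_le hx

/-! ### Restriction of derivations to `B` -/

theorem borelHom_borelProj_of_mem_arrowSpan {i j : V} [IsEmpty (QA.Hom j i)]
    {x : DualExtension k ZB ZA} (hx : x ∈ arrowSpan k (dualRelations ZB ZA) i j) :
    borelHom k ZB ZA (borelProj hZA x) = x := by
  have arrowSpan_le : arrowSpan k (dualRelations ZB ZA) i j ≤ LinearMap.eqLocus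
      ((borelHom k ZB ZA).toLinearMap ∘ₗ (borelProj hZA).toLinearMap) LinearMap.id := by
    rw [arrowSpan_le_iff]
    rintro (b | a)
    · exact (congrArg _ (borelProj_arrowClass_inclArrow hZA b)).trans (borelHom_arrowClass b)
    · exact isEmptyElim a
  exact arrowSpan_le hx

variable (hdisj : ∀ i j, QB.Hom i j → IsEmpty (QA.Hom j i))

include hdisj in
theorem borelHom_borelProj_apply_borelHom (f : gradedDer k (dualRelations ZB ZA))
    (x : MonomialAlgebra k ZB) :
    borelHom k ZB ZA (borelProj hZA (f.1 (borelHom k ZB ZA x))) = f.1 (borelHom k ZB ZA x) := by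
  have comp_eq : (borelHom k ZB ZA).toLinearMap ∘ₗ (borelProj hZA).toLinearMap ∘ₗ f.1 ∘ₗ
      (borelHom k ZB ZA).toLinearMap = f.1 ∘ₗ (borelHom k ZB ZA).toLinearMap := by
    refine MonomialAlgebra.linearMap_ext fun p => ?_
    change borelHom k ZB ZA (borelProj hZA (f.1 (borelHom k ZB ZA (pathClass k ZB p)))) =
      f.1 (borelHom k ZB ZA (pathClass k ZB p))
    induction p using QPath.induction with
    | idem i =>
      change borelHom k ZB ZA (borelProj hZA (f.1 (borelHom k ZB ZA (vertexClass k ZB i)))) =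
        f.1 (borelHom k ZB ZA (vertexClass k ZB i))
      rw [borelHom_vertexClass, gradedDer_apply_vertexClass, map_zero, map_zero]
    | @arrow_comp i j b p h ih =>
      have := hdisj i j b
      have apply_arrow : borelHom k ZB ZA (borelProj hZA
          (f.1 (borelHom k ZB ZA (pathClass k ZB (QPath.arrow b))))) =
            f.1 (borelHom k ZB ZA (pathClass k ZB (QPath.arrow b))) :=
        borelHom_borelProj_of_mem_arrowSpan hZA
          (gradedDer_apply_mem_arrowSpan f
            (borelHom_mem_arrowSpan (arrowClass_mem_arrowSpan b)))
      rw [pathClass_comp, map_mul, derivation_apply_mul f.2.1]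
      simp only [map_add, map_mul, ih, apply_arrow, borelProj_borelHom]
  exact LinearMap.congr_fun comp_eq x

theorem borelProj_comp_comp_borelHom_mem_gradedDer (f : gradedDer k (dualRelations ZB ZA)) :
    (borelProj hZA).toLinearMap ∘ₗ f.1 ∘ₗ (borelHom k ZB ZA).toLinearMap ∈ gradedDer k ZB := by
  refine mem_gradedDer (fun x y => ?_) (fun i => ?_) fun b => ?_
  · simp only [LinearMap.comp_apply, AlgHom.toLinearMap_apply, map_mul, map_add,
      derivation_apply_mul f.2.1, borelProj_borelHom]
  · simp only [LinearMap.comp_apply, AlgHom.toLinearMap_apply, borelHom_vertexClass,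
      gradedDer_apply_vertexClass, map_zero]
  · exact borelProj_mem_arrowSpan hZA (gradedDer_apply_mem_arrowSpan f
      (borelHom_mem_arrowSpan (arrowClass_mem_arrowSpan b)))

/-- The restriction to `B` of the derivations of degree zero of the dual extension. Its values
already lie in the image of `B`; the projection only identifies them with elements of `B`. -/
def restrictBorel : gradedDer k (dualRelations ZB ZA) →ₗ⁅k⁆ gradedDer k ZB where
  toFun f := ⟨_, borelProj_comp_comp_borelHom_mem_gradedDer hZA f⟩
  map_add' f g := Subtype.ext (by
    simp [LinearMap.add_comp, LinearMap.comp_add])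
  map_smul' c f := Subtype.ext (by
    simp [LinearMap.smul_comp, LinearMap.comp_smul])
  map_lie' {f g} := Subtype.ext (LinearMap.ext fun x => by
    change borelProj hZA (f.1 (g.1 (borelHom k ZB ZA x)) - g.1 (f.1 (borelHom k ZB ZA x))) =
      borelProj hZA (f.1 (borelHom k ZB ZA (borelProj hZA (g.1 (borelHom k ZB ZA x))))) -
        borelProj hZA (g.1 (borelHom k ZB ZA (borelProj hZA (f.1 (borelHom k ZB ZA x)))))
    rw [borelHom_borelProj_apply_borelHom hZA hdisj, borelHom_borelProj_apply_borelHom hZA hdisj,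
      map_sub])

theorem borelHom_restrictBorel (f : gradedDer k (dualRelations ZB ZA))
    (x : MonomialAlgebra k ZB) :
    borelHom k ZB ZA ((restrictBorel hZA hdisj f).1 x) = f.1 (borelHom k ZB ZA x) :=
  borelHom_borelProj_apply_borelHom hZA hdisj f x

end Borel

/-! ### Derivations with prescribed values on the arrows -/

section OfArrows

open TrivSqZeroExt

variable {k : Type u} [Field k] {V : Type w} [DecidableEq V] [Fintype V] {Q : Quiver.{v} V}
  {Z : Set (QPath Q)}

theorem vertexClass_mul_of_mem_arrowSpan {i j : V} {x : MonomialAlgebra k Z}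
    (hx : x ∈ arrowSpan k Z i j) : vertexClass k Z j * x = x := by
  have arrowSpan_le : arrowSpan k Z i j ≤
      LinearMap.eqLocus (LinearMap.mulLeft k (vertexClass k Z j)) LinearMap.id :=
    arrowSpan_le_iff.2 vertexClass_mul_arrowClass
  exact arrowSpan_le hx

theorem mul_vertexClass_of_mem_arrowSpan {i j : V} {x : MonomialAlgebra k Z}
    (hx : x ∈ arrowSpan k Z i j) : x * vertexClass k Z i = x := by
  have arrowSpan_le : arrowSpan k Z i j ≤
      LinearMap.eqLocus (LinearMap.mulRight k (vertexClass k Z i)) LinearMap.id :=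
    arrowSpan_le_iff.2 arrowClass_mul_vertexClass
  exact arrowSpan_le hx

variable (δ : ∀ ⦃i j : V⦄, Q.Hom i j → MonomialAlgebra k Z)
  (hδ : ∀ ⦃i j : V⦄ (a : Q.Hom i j), δ a ∈ arrowSpan k Z i j)

/-- The first order deformation `a + ε δ(a)` of the arrows; the square-zero extension of the
monomial algebra by itself plays the role of the dual numbers over it. -/
def deformRep : QuiverRep Q (TrivSqZeroExt (MonomialAlgebra k Z) (MonomialAlgebra k Z)) where
  vertex i := inl (vertexClass k Z i)
  arrow a := inl (arrowClass k Z a) + inr (δ a)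
  complete := vertexClass_complete.map (inlHom (MonomialAlgebra k Z) (MonomialAlgebra k Z))
  vertex_mul_arrow a := by
    rw [mul_add, inl_mul_inl, inl_mul_inr, smul_eq_mul, vertexClass_mul_arrowClass,
      vertexClass_mul_of_mem_arrowSpan (hδ a)]
  arrow_mul_vertex a := by
    rw [add_mul, inl_mul_inl, inr_mul_inl, op_smul_eq_mul, arrowClass_mul_vertexClass,
      mul_vertexClass_of_mem_arrowSpan (hδ a)]

theorem fst_eval_deformRep (p : QPath Q) :
    ((deformRep δ hδ).eval p).fst = pathClass k Z p := by
  induction p using QPath.induction with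
  | idem i => rfl
  | arrow_comp a p h ih =>
    rw [QuiverRep.eval_arrow_comp, fst_mul, ih, pathClass_comp]
    exact congrArg (· * pathClass k Z p) (add_zero _)

/-- The sum over the positions in a path of the results of replacing the arrow `a` there by
`δ a`. -/
def leibniz (p : QPath Q) : MonomialAlgebra k Z := ((deformRep δ hδ).eval p).snd

theorem leibniz_comp (p q : QPath Q) (h : q.tgt = p.src) :
    leibniz δ hδ (p.comp q h) =
      leibniz δ hδ p * pathClass k Z q + pathClass k Z p * leibniz δ hδ q := by
  rw [leibniz, QuiverRep.eval_comp, snd_mul, fst_eval_deformRep, fst_eval_deformRep, add_comm]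
  rfl

theorem leibniz_arrow {i j : V} (a : Q.Hom i j) : leibniz δ hδ (QPath.arrow a) = δ a := by
  rw [leibniz, QuiverRep.eval_arrow]
  exact zero_add _

theorem eval_deformRep_eq_zero {p : QPath Q} (hp : p ∈ Z) (h : leibniz δ hδ p = 0) :
    (deformRep δ hδ).eval p = 0 :=
  TrivSqZeroExt.ext ((fst_eval_deformRep δ hδ p).trans (pathClass_eq_zero hp)) h

variable (hZ : ∀ z ∈ Z, leibniz δ hδ z = 0)

/-- The homomorphism `x ↦ x + ε D(x)` to the square-zero extension that corresponds to the
derivation `D` with values `δ` on the arrows. -/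
def deformHom :
    MonomialAlgebra k Z →ₐ[k] TrivSqZeroExt (MonomialAlgebra k Z) (MonomialAlgebra k Z) :=
  MonomialAlgebra.lift (deformRep δ hδ) fun z hz => eval_deformRep_eq_zero δ hδ hz (hZ z hz)

theorem deformHom_pathClass (p : QPath Q) :
    deformHom δ hδ hZ (pathClass k Z p) = (deformRep δ hδ).eval p :=
  MonomialAlgebra.lift_pathClass _ _ p

theorem fst_deformHom (x : MonomialAlgebra k Z) : (deformHom δ hδ hZ x).fst = x := by
  have comp_eq_id : (fstHom k (MonomialAlgebra k Z) (MonomialAlgebra k Z)).toLinearMap ∘ₗ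
      (deformHom δ hδ hZ).toLinearMap = LinearMap.id :=
    MonomialAlgebra.linearMap_ext fun p =>
      (congrArg fst (deformHom_pathClass δ hδ hZ p)).trans
        (fst_eval_deformRep δ hδ p)
  exact LinearMap.congr_fun comp_eq_id x

theorem snd_deformHom_pathClass (p : QPath Q) :
    (deformHom δ hδ hZ (pathClass k Z p)).snd = leibniz δ hδ p :=
  congrArg snd (deformHom_pathClass δ hδ hZ p)

theorem snd_deformHom_arrowClass {i j : V} (a : Q.Hom i j) :
    (deformHom δ hδ hZ (arrowClass k Z a)).snd = δ a :=
  (snd_deformHom_pathClass δ hδ hZ _).trans (leibniz_arrow δ hδ a)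

/-- The derivation of degree zero with given values on the arrows. -/
def gradedDerOfArrows : gradedDer k Z where
  val :=
    { toFun x := (deformHom δ hδ hZ x).snd
      map_add' x y := by rw [map_add, snd_add]
      map_smul' c x := by rw [map_smul, snd_smul, RingHom.id_apply] }
  property := by
    refine mem_gradedDer (fun x y => ?_) (fun i => ?_) fun a => ?_
    · change (deformHom δ hδ hZ (x * y)).snd =
        (deformHom δ hδ hZ x).snd * y + x * (deformHom δ hδ hZ y).snd
      rw [map_mul, snd_mul, fst_deformHom, fst_deformHom, smul_eq_mul, op_smul_eq_mul, add_comm]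
    · exact snd_deformHom_pathClass δ hδ hZ (QPath.idem Q i)
    · exact Set.mem_of_eq_of_mem (snd_deformHom_arrowClass δ hδ hZ a) (hδ a)

theorem gradedDerOfArrows_arrowClass {i j : V} (a : Q.Hom i j) :
    (gradedDerOfArrows δ hδ hZ).1 (arrowClass k Z a) = δ a :=
  snd_deformHom_arrowClass δ hδ hZ a

end OfArrows

/-! ### Extension of derivations from `B` -/

section Extend

variable {k : Type u} [Field k] {V : Type w} [DecidableEq V] [Fintype V] {QB QA : Quiver.{v} V}
  {ZB : Set (QPath QB)} {ZA : Set (QPath QA)}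

variable (ZA) in
/-- The values of a derivation of `B` on the arrows of `B`, extended by zero to the arrows of the
dual extension. -/
def extendArrows (g : gradedDer k ZB) :
    ∀ ⦃i j : V⦄, (dualQuiver QB QA).Hom i j → DualExtension k ZB ZA
  | _, _, Sum.inl b => borelHom k ZB ZA (g.1 (arrowClass k ZB b))
  | _, _, Sum.inr _ => 0

theorem extendArrows_mem_arrowSpan (g : gradedDer k ZB) :
    ∀ ⦃i j : V⦄ (a : (dualQuiver QB QA).Hom i j),
      extendArrows ZA g a ∈ arrowSpan k (dualRelations ZB ZA) i j
  | _, _, Sum.inl b => borelHom_mem_arrowSpan (gradedDer_apply_arrowClass g b)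
  | _, _, Sum.inr _ => zero_mem _

theorem borelHom_mul_arrowClass_opArrow {i j l : V} {x : MonomialAlgebra k ZB}
    (hx : x ∈ arrowSpan k ZB j l) (a : QA.Hom j i) :
    borelHom k ZB ZA x * arrowClass k (dualRelations ZB ZA) (opArrow QB QA j i a) = 0 := by
  have arrowSpan_le : arrowSpan k ZB j l ≤ LinearMap.ker
      (LinearMap.mulRight k (arrowClass k (dualRelations ZB ZA) (opArrow QB QA j i a)) ∘ₗ
        (borelHom k ZB ZA).toLinearMap) := by
    rw [arrowSpan_le_iff]
    intro b
    change borelHom k ZB ZA (arrowClass k ZB b) *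
      arrowClass k (dualRelations ZB ZA) (opArrow QB QA j i a) = 0
    rw [borelHom_arrowClass, arrowClass_inclArrow_mul_arrowClass_opArrow]
  exact arrowSpan_le hx

theorem leibniz_extendArrows_map (g : gradedDer k ZB) (p : QPath QB) :
    leibniz (extendArrows ZA g) (extendArrows_mem_arrowSpan g) (p.map (inclArrow QB QA)) =
      borelHom k ZB ZA (g.1 (pathClass k ZB p)) := by
  induction p using QPath.induction with
  | idem i => exact ((congrArg _ (gradedDer_apply_vertexClass g i)).trans (map_zero _)).symm
  | @arrow_comp i j b p h ih =>
    rw [QPath.map_comp, pathClass_comp, derivation_apply_mul g.2.1, map_add, map_mul, map_mul,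
      borelHom_pathClass, ← ih]
    refine (leibniz_comp _ _ (QPath.arrow (inclArrow QB QA i j b)) (p.map _) h).trans ?_
    rw [leibniz_arrow, ← arrowClass, ← arrowClass, borelHom_arrowClass]
    rfl

theorem leibniz_extendArrows_opPath (g : gradedDer k ZB) (p : QPath QA) :
    leibniz (extendArrows ZA g) (extendArrows_mem_arrowSpan g) (opPath QB QA p) = 0 := by
  induction p using QPath.induction with
  | idem i => rfl
  | @arrow_comp i j a p h ih =>
    rw [QPath.opPath_arrow_comp]
    refine (leibniz_comp _ _ (opPath QB QA p) (QPath.arrow (opArrow QB QA i j a)) h.symm).trans ?_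
    rw [ih, zero_mul, zero_add, leibniz_arrow]
    exact mul_zero _

theorem leibniz_extendArrows_eq_zero (g : gradedDer k ZB) :
    ∀ z ∈ dualRelations ZB ZA,
      leibniz (extendArrows ZA g) (extendArrows_mem_arrowSpan g) z = 0 := by
  rintro _ ((⟨z, hz, rfl⟩ | ⟨z, -, rfl⟩) | ⟨i, j, l, a, b, rfl⟩)
  · rw [leibniz_extendArrows_map, pathClass_eq_zero hz, map_zero, map_zero]
  · exact leibniz_extendArrows_opPath g z
  · refine (leibniz_comp _ _ (QPath.arrow (inclArrow QB QA j l b))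
      (QPath.arrow (opArrow QB QA j i a)) rfl).trans ?_
    rw [leibniz_arrow, leibniz_arrow]
    change borelHom k ZB ZA (g.1 (arrowClass k ZB b)) *
      arrowClass k (dualRelations ZB ZA) (opArrow QB QA j i a) + _ * 0 = 0
    rw [borelHom_mul_arrowClass_opArrow (gradedDer_apply_arrowClass g b), mul_zero, add_zero]

variable (ZA) in
/-- The extension of a derivation of `B` to the dual extension by zero on the arrows of `A`. -/
def extendDer (g : gradedDer k ZB) : gradedDer k (dualRelations ZB ZA) :=
  gradedDerOfArrows (extendArrows ZA g) (extendArrows_mem_arrowSpan g)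
    (leibniz_extendArrows_eq_zero g)

theorem extendDer_borelHom (g : gradedDer k ZB) (x : MonomialAlgebra k ZB) :
    (extendDer ZA g).1 (borelHom k ZB ZA x) = borelHom k ZB ZA (g.1 x) := by
  have comp_eq : (extendDer ZA g).1 ∘ₗ (borelHom k ZB ZA).toLinearMap =
      (borelHom k ZB ZA).toLinearMap ∘ₗ g.1 :=
    MonomialAlgebra.linearMap_ext fun p =>
      (congrArg (extendDer ZA g).1 (borelHom_pathClass p)).trans
        ((snd_deformHom_pathClass _ _ _ _).trans (leibniz_extendArrows_map g p))
  exact LinearMap.congr_fun comp_eq x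

theorem extendDer_opArrow (g : gradedDer k ZB) {i j : V} (a : QA.Hom i j) :
    (extendDer ZA g).1 (arrowClass k (dualRelations ZB ZA) (opArrow QB QA i j a)) = 0 :=
  gradedDerOfArrows_arrowClass _ _ _ _

theorem gradedDer_dualRelations_ext {f g : gradedDer k (dualRelations ZB ZA)}
    (hB : ∀ x, f.1 (borelHom k ZB ZA x) = g.1 (borelHom k ZB ZA x))
    (hA : ∀ {i j : V} (a : QA.Hom i j),
      f.1 (arrowClass k (dualRelations ZB ZA) (opArrow QB QA i j a)) =
        g.1 (arrowClass k (dualRelations ZB ZA) (opArrow QB QA i j a))) : f = g := by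
  refine gradedDer_ext ?_
  rintro i j (b | a)
  · have hb := hB (arrowClass k ZB b)
    rwa [borelHom_arrowClass] at hb
  · exact hA a

theorem extendDer_lie (f g : gradedDer k ZB) :
    extendDer ZA ⁅f, g⁆ = ⁅extendDer ZA f, extendDer ZA g⁆ := by
  refine gradedDer_dualRelations_ext (fun x => ?_) fun a => ?_
  · change _ = (extendDer ZA f).1 ((extendDer ZA g).1 _) -
      (extendDer ZA g).1 ((extendDer ZA f).1 _)
    simp only [extendDer_borelHom]
    exact map_sub _ _ _
  · change _ = (extendDer ZA f).1 ((extendDer ZA g).1 _) -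
      (extendDer ZA g).1 ((extendDer ZA f).1 _)
    simp only [extendDer_opArrow, map_zero, sub_zero]

variable (k ZB ZA) in
/-- The extension of the derivations of degree zero of `B` to the dual extension by zero on the
arrows of `A`, as a homomorphism of Lie algebras. -/
def extendBorel : gradedDer k ZB →ₗ⁅k⁆ gradedDer k (dualRelations ZB ZA) where
  toFun := extendDer ZA
  map_add' f g := by
    refine gradedDer_dualRelations_ext (fun x => ?_) fun a => ?_
    · change _ = (extendDer ZA f).1 _ + (extendDer ZA g).1 _
      simp only [extendDer_borelHom]
      exact map_add _ _ _
    · change _ = (extendDer ZA f).1 _ + (extendDer ZA g).1 _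
      simp only [extendDer_opArrow, add_zero]
  map_smul' c f := by
    refine gradedDer_dualRelations_ext (fun x => ?_) fun a => ?_
    · change _ = c • (extendDer ZA f).1 _
      simp only [extendDer_borelHom]
      exact map_smul (borelHom k ZB ZA) _ _
    · change _ = c • (extendDer ZA f).1 _
      simp only [extendDer_opArrow, smul_zero]
  map_lie' {f g} := extendDer_lie f g

theorem extendBorel_borelHom (g : gradedDer k ZB) (x : MonomialAlgebra k ZB) :
    (extendBorel k ZB ZA g).1 (borelHom k ZB ZA x) = borelHom k ZB ZA (g.1 x) :=
  extendDer_borelHom g x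

theorem extendBorel_opArrow (g : gradedDer k ZB) {i j : V} (a : QA.Hom i j) :
    (extendBorel k ZB ZA g).1 (arrowClass k (dualRelations ZB ZA) (opArrow QB QA i j a)) = 0 :=
  extendDer_opArrow g a

theorem extendBorel_apply_of_mem_arrowSpan (g : gradedDer k ZB) {i j : V} [IsEmpty (QB.Hom i j)]
    {x : DualExtension k ZB ZA} (hx : x ∈ arrowSpan k (dualRelations ZB ZA) i j) :
    (extendBorel k ZB ZA g).1 x = 0 := by
  have arrowSpan_le : arrowSpan k (dualRelations ZB ZA) i j ≤
      LinearMap.ker (extendBorel k ZB ZA g).1 := by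
    rw [arrowSpan_le_iff]
    rintro (b | a)
    · exact isEmptyElim b
    · exact extendBorel_opArrow g a
  exact arrowSpan_le hx

variable (hZA : ∀ z ∈ ZA, z.length ≠ 0) (hdisj : ∀ i j, QB.Hom i j → IsEmpty (QA.Hom j i))

include hZA in
theorem borelHom_injective : Function.Injective (borelHom k ZB ZA) :=
  Function.LeftInverse.injective (borelProj_borelHom hZA)

theorem restrictBorel_extendBorel (g : gradedDer k ZB) :
    restrictBorel hZA hdisj (extendBorel k ZB ZA g) = g := by
  refine Subtype.ext (LinearMap.ext fun x => borelHom_injective hZA ?_)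
  rw [borelHom_restrictBorel, extendBorel_borelHom]

theorem restrictBorel_adDiag (c : V → k) :
    restrictBorel hZA hdisj (adDiag k (dualRelations ZB ZA) c) = adDiag k ZB c := by
  refine gradedDer_ext fun {i j} b => borelHom_injective (ZA := ZA) hZA ?_
  rw [borelHom_restrictBorel, borelHom_arrowClass, adDiag_apply_arrowClass,
    adDiag_apply_arrowClass, map_smul, borelHom_arrowClass]

theorem restrictBorel_eq_zero_iff (f : gradedDer k (dualRelations ZB ZA)) :
    restrictBorel hZA hdisj f = 0 ↔ ∀ x, f.1 (borelHom k ZB ZA x) = 0 := by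
  refine ⟨fun hf x => ?_, fun hf => ?_⟩
  · rw [← borelHom_restrictBorel hZA hdisj, hf]
    exact map_zero _
  · refine Subtype.ext (LinearMap.ext fun x => borelHom_injective (ZA := ZA) hZA ?_)
    rw [borelHom_restrictBorel, hf]
    exact (map_zero _).symm

theorem extendBorel_lie_eq_zero (g : gradedDer k ZB) {f : gradedDer k (dualRelations ZB ZA)}
    (hf : restrictBorel hZA hdisj f = 0) : ⁅extendBorel k ZB ZA g, f⁆ = 0 := by
  rw [restrictBorel_eq_zero_iff] at hf
  refine gradedDer_dualRelations_ext (fun x => ?_) fun {i j} a => ?_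
  · change (extendBorel k ZB ZA g).1 (f.1 _) - f.1 ((extendBorel k ZB ZA g).1 _) = 0
    rw [extendBorel_borelHom, hf, hf, map_zero, sub_zero]
  · have : IsEmpty (QB.Hom j i) := ⟨fun b => (hdisj j i b).false a⟩
    change (extendBorel k ZB ZA g).1 (f.1 _) - f.1 ((extendBorel k ZB ZA g).1 _) = 0
    rw [extendBorel_opArrow, map_zero, sub_zero, extendBorel_apply_of_mem_arrowSpan g
      (gradedDer_apply_arrowClass f (opArrow QB QA i j a))]

theorem mem_relDerivations_iff (f : gradedDer k (dualRelations ZB ZA)) :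
    f.1 ∈ relDerivations k (borel k ZB ZA) ↔ restrictBorel hZA hdisj f = 0 := by
  rw [restrictBorel_eq_zero_iff]
  constructor
  · intro hf x
    have apply_one : f.1 1 = 0 := by simpa using derivation_apply_mul f.2.1 1 1
    simpa [apply_one] using hf.2 (borelHom k ZB ZA x) ⟨x, rfl⟩ 1 (one_mem _) 1
  · refine fun hf => ⟨f.2.1, ?_⟩
    rintro _ ⟨x, rfl⟩ _ ⟨y, rfl⟩ z
    change f.1 (borelHom k ZB ZA x * z * borelHom k ZB ZA y) =
      borelHom k ZB ZA x * f.1 z * borelHom k ZB ZA y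
    rw [derivation_apply_mul f.2.1, derivation_apply_mul f.2.1, hf, hf, zero_mul, zero_add,
      mul_zero, add_zero]

end Extend

/-! ### Classes of derivations of degree zero -/

section Classes

variable {k : Type u} [Field k] {A : Type v} [Ring A] [Algebra k A]
  (D P : LieSubalgebra k (Module.End k A)) (hD : D ≤ derivations k A)

/-- The projection from the elements of `D` lying in `P` to their classes modulo the inner
derivations in `D`. -/
def toClassesIn : ↥(D ⊓ P) →ₗ⁅k⁆ classesIn k D P (innerIdeal k D hD) where
  toFun f := ⟨LieSubmodule.Quotient.mk ⟨f.1, f.2.1⟩, ⟨f.1, f.2.1⟩, f.2.2, rfl⟩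
  map_add' _ _ := rfl
  map_smul' _ _ := rfl
  map_lie' := rfl

theorem toClassesIn_surjective : Function.Surjective (toClassesIn D P hD) := by
  rintro ⟨_, f, hf, rfl⟩
  exact ⟨⟨f.1, f.2, hf⟩, rfl⟩

theorem toClassesIn_eq_zero_iff (f : ↥(D ⊓ P)) :
    toClassesIn D P hD f = 0 ↔ ∃ x, f.1 = ad k x := by
  rw [← Subtype.coe_inj]
  exact LieSubmodule.Quotient.mk_eq_zero' (N := innerIdeal k D hD) (m := ⟨f.1, f.2.1⟩)

end Classes

section GradedDerClass

variable (k : Type u) [Field k] {V : Type w} [DecidableEq V] [Fintype V] {Q : Quiver.{v} V}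
  (Z : Set (QPath Q))

/-- The class in `HH¹` of a derivation of degree zero of a monomial algebra. -/
def gradedDerClass : gradedDer k Z →ₗ⁅k⁆ HH1DegOne k (lengthGrading k Z) :=
  toClassesIn _ _ le_rfl

theorem gradedDerClass_surjective : Function.Surjective (gradedDerClass k Z) :=
  toClassesIn_surjective _ _ _

variable {k Z}

theorem gradedDerClass_eq_zero_iff_exists_ad_eq (f : gradedDer k Z) :
    gradedDerClass k Z f = 0 ↔ ∃ x, f.1 = ad k x :=
  toClassesIn_eq_zero_iff _ _ _ f

theorem gradedDerClass_eq_zero_iff (f : gradedDer k Z) :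
    gradedDerClass k Z f = 0 ↔ ∃ c, adDiag k Z c = f :=
  (gradedDerClass_eq_zero_iff_exists_ad_eq f).trans (exists_ad_eq_iff f)

end GradedDerClass

section RelClass

variable {k : Type u} [Field k] {V : Type w} [DecidableEq V] [Fintype V] {QB QA : Quiver.{v} V}
  {ZB : Set (QPath QB)} {ZA : Set (QPath QA)}
  (hZA : ∀ z ∈ ZA, z.length ≠ 0) (hdisj : ∀ i j, QB.Hom i j → IsEmpty (QA.Hom j i))

/-- The class in relative `HH¹` of a derivation of degree zero of the dual extension that vanishes
on `B`. -/
def relClass : (restrictBorel hZA hdisj (k := k) (ZB := ZB)).ker →ₗ⁅k⁆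
    RelHH1DegOne k (lengthGrading k (dualRelations ZB ZA)) (borel k ZB ZA) :=
  (toClassesIn (relDerivations k (borel k ZB ZA))
    (degreePreserving k (lengthGrading k (dualRelations ZB ZA))) inf_le_left).comp
    { toFun f := ⟨f.1.1, (mem_relDerivations_iff hZA hdisj f.1).2 f.2, f.1.2.2⟩
      map_add' _ _ := rfl
      map_smul' _ _ := rfl
      map_lie' := rfl }

theorem relClass_surjective :
    Function.Surjective (relClass hZA hdisj (k := k) (ZB := ZB)) := by
  intro x
  obtain ⟨f, rfl⟩ := toClassesIn_surjective _ _ _ x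
  let f' : gradedDer k (dualRelations ZB ZA) := ⟨f.1, f.2.1.1, f.2.2⟩
  exact ⟨⟨f', (mem_relDerivations_iff hZA hdisj f').1 f.2.1⟩, rfl⟩

theorem relClass_eq_zero_iff (f : (restrictBorel hZA hdisj (k := k) (ZB := ZB)).ker) :
    relClass hZA hdisj f = 0 ↔ gradedDerClass k (dualRelations ZB ZA) f.1 = 0 :=
  (toClassesIn_eq_zero_iff _ _ _ _).trans (gradedDerClass_eq_zero_iff_exists_ad_eq f.1).symm

theorem gradedDerClass_eq_zero_iff_exists_restrictBorel_eq (g : gradedDer k ZB) :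
    gradedDerClass k ZB g = 0 ↔
      ∃ f, gradedDerClass k (dualRelations ZB ZA) f = 0 ∧ restrictBorel hZA hdisj f = g := by
  simp only [gradedDerClass_eq_zero_iff]
  constructor
  · rintro ⟨c, rfl⟩
    exact ⟨_, ⟨c, rfl⟩, restrictBorel_adDiag hZA hdisj c⟩
  · rintro ⟨_, ⟨c, rfl⟩, rfl⟩
    exact ⟨c, (restrictBorel_adDiag hZA hdisj c).symm⟩

end RelClass

end DualExt

end

open DualExt in
theorem theoremB_general {k : Type u} [Field k] [CharZero k] {V : Type w} [Fintype V]
    [DecidableEq V] (QB QA : Quiver.{v} V) [∀ i j, Finite (QB.Hom i j)]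
    (hdisj : ∀ i j, QB.Hom i j → IsEmpty (QA.Hom j i)) (ZB : Set (QPath QB)) (ZA : Set (QPath QA))
    (hZA : ∀ z ∈ ZA, z.length ≠ 0) :
    Nonempty
      (HH1DegOne k (lengthGrading k (dualRelations ZB ZA)) ≃ₗ⁅k⁆
        (HH1DegOne k (lengthGrading k ZB) ×
          RelHH1DegOne k (lengthGrading k (dualRelations ZB ZA)) (borel k ZB ZA))) := by
  obtain ⟨φ, φ_lie, adDiag_φ⟩ := exists_retraction_adDiag k ZB
  refine nonempty_lieEquiv_prod (restrictBorel hZA hdisj) (extendBorel k ZB ZA)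
    (adDiag k (dualRelations ZB ZA) ∘ₗ φ) (restrictBorel_extendBorel hZA hdisj)
    (fun g f => extendBorel_lie_eq_zero hZA hdisj g) (fun g => adDiag_lie (φ g))
    (fun f g => ?_) (gradedDerClass k _) (gradedDerClass k ZB) (relClass hZA hdisj)
    (gradedDerClass_surjective k _) (gradedDerClass_surjective k ZB) (relClass_surjective hZA hdisj)
    (gradedDerClass_eq_zero_iff_exists_restrictBorel_eq hZA hdisj) (relClass_eq_zero_iff hZA hdisj)
    (fun g => (gradedDerClass_eq_zero_iff _).2 ⟨φ g, rfl⟩) fun f hf => ?_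
  · rw [LinearMap.comp_apply, φ_lie, map_zero]
  · obtain ⟨c, rfl⟩ := (gradedDerClass_eq_zero_iff f).1 hf
    rw [LinearMap.comp_apply, restrictBorel_adDiag, restrictBorel_adDiag, adDiag_φ]

theorem theoremB {k : Type u} [Field k] [IsAlgClosed k] [CharZero k] {n : ℕ}
    (QB QA : Quiver.{v} (Fin n))
    (hfB : ∀ i j : Fin n, Finite (QB.Hom i j)) (hfA : ∀ i j : Fin n, Finite (QA.Hom i j))
    (hQB : ∀ i j : Fin n, QB.Hom i j → i < j) (hQA : ∀ i j : Fin n, QA.Hom i j → i < j)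
    (ZB : Set (DualExt.QPath QB)) (ZA : Set (DualExt.QPath QA))
    (hZB : ∀ r ∈ ZB, 2 ≤ r.length) (hZA : ∀ r ∈ ZA, 2 ≤ r.length) :
    Nonempty
      (DualExt.HH1DegOne k (DualExt.lengthGrading k (DualExt.dualRelations ZB ZA)) ≃ₗ⁅k⁆
        (DualExt.HH1DegOne k (DualExt.lengthGrading k ZB) ×
          DualExt.RelHH1DegOne k (DualExt.lengthGrading k (DualExt.dualRelations ZB ZA))
            (DualExt.borel k ZB ZA))) :=
  theoremB_general QB QA (fun i j b => ⟨fun a => lt_asymm (hQB i j b) (hQA j i a)⟩) ZB ZA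
    fun r hr => by have := hZA r hr; lia
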